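/- Let $\Omega=\{z\in\mathbb{C} : \operatorname{Im} z\ge 0,\ |z|\ge 1\}$ and let $f$ be a function analytic in a neighborhood of $\Omega$ which does not vanish on $\mathbb{R}\cap\Omega$. For $r\ge 1$ let $n(r)$ be the number of zeros of $f$ in $\{z : \operatorname{Im} z\ge 0,\ 1\le |z|\le r\}$, counted with multiplicity. Suppose that there are a constant $C_0$ and a real number $\rho$, not an integer, such that $$n(r)\le C_0(1+r^{\rho})\quad\text{for all } r\ge 1$$ and $$\left|\frac{f'(x)}{f(x)}\right|\le C_0\,(1+|x|^{\rho-1})\quad\text{for all } x\in\mathbb{R}\text{ with }|x|\ge 1;$$ in the case $\rho<1$ suppose moreover that $\left|\frac{f'(x)}{f(x)}\right|\le C_0|x|^{\rho-1}$ for all $x\in\mathbb{R}$ with $|x|\ge 1$. Suppose in addition that there are constants $\rho_1$, $C_1$ such that $\log|f(z)|\le C_1(1+|z|^{\rho_1})$ for all $z\in\Omega$ (with $\log 0=-\infty$). Then there is a constant $C$ such that $$|f(z)|\le C e^{C|z|^{\rho}}\quad\text{for all } z\in\Omega.$$ -/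

import Mathlib

open scoped ENNReal

/-- The closed upper half plane with the open unit disk removed:
`Ω = {z : Im z ≥ 0, |z| ≥ 1}`. -/
def upperExterior : Set ℂ := {z | 0 ≤ z.im ∧ 1 ≤ ‖z‖}

/-- The number `n(r)` of zeros of `f` in `{z : Im z ≥ 0, 1 ≤ |z| ≤ r}`, counted with multiplicity,
as an element of `[0, ∞]`. The multiplicity of a point is the order of vanishing of `f` there, which
is `0` where `f` is analytic and nonzero; the sum is an unconditional sum in `[0, ∞]`. -/
noncomputable def zeroCount (f : ℂ → ℂ) (r : ℝ) : ℝ≥0∞ :=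
  ∑' z : {z : ℂ | z ∈ upperExterior ∧ ‖z‖ ≤ r}, (analyticOrderAt f (z : ℂ) : ℝ≥0∞)

/-! In the coordinate ζ = log z the exterior of a half disc becomes a half strip, and the
Phragmén–Lindelöf principle is applied there to a logarithm of f rather than to f. Control of |f| on
the axis would not suffice: exp(-iz) has modulus one there. The bound on f'/f controls the argument
too: integrated along each ray of the axis, it shows that a continuous branch of log f is O(|x|^σ),
where σ = max(ρ, 0).

For a logarithm to exist inside, the zeros with s ≤ |a| ≤ R are divided out by a finite product B of
half-plane Blaschke factors with convergence factors of genus p = ⌊σ⌋. On the axis |B| = 1, and the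
variation of arg B there, like log |B| from above in the half plane, is O(r^σ) uniformly in R. This
is where ρ must not be an integer: for ρ > 0 the strict inequalities p < ρ < p + 1 turn the sums
over near and far zeros into geometric series over dyadic radii (`exists_sum_genusWeight_le`),
whereas equality would cost a logarithm.

Hence H = log(f/B) satisfies |H| ≤ K|z|^σ on the axis and on the arc |z| = s, with K independent of
R (`norm_le_on_sides`). On |z| = R only Re H ≤ A R^M is known, from the growth hypothesis and a
lower bound for |B|, for R chosen by pigeonhole away from the zeros (`exists_radius_gap`). A
Borel–Carathéodory estimate turns this into a bound for |H| when |z| ≤ R/8. Since that bound is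
polynomial in R, a weight of order 1/2 in z absorbs it for large R, which leaves |H(z)| ≤ eK|z|^σ
with no trace of ρ₁ (`norm_le_of_strip_family`). Finally |f| = |B| exp(Re H). -/

open ComplexConjugate

/-! ### Borel–Carathéodory and Phragmén–Lindelöf estimates on rectangles -/

open Complex in
/-- Maximum modulus principle on the rectangle `[α, β] × [0, π]`. -/
theorem norm_le_of_norm_le_sides {φ : ℂ → ℂ} {α β M : ℝ} (hαβ : α < β)
    (hφ : AnalyticOnNhd ℂ φ (Set.Icc α β ×ℂ Set.Icc 0 Real.pi))
    (hside : ∀ ζ ∈ Set.Icc α β ×ℂ Set.Icc 0 Real.pi,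
      (ζ.im = 0 ∨ ζ.im = Real.pi ∨ ζ.re = α) → ‖φ ζ‖ ≤ M)
    (hright : ∀ ζ ∈ Set.Icc α β ×ℂ Set.Icc 0 Real.pi, ζ.re = β → ‖φ ζ‖ ≤ M)
    {ζ : ℂ} (hζ : ζ ∈ Set.Icc α β ×ℂ Set.Icc 0 Real.pi) : ‖φ ζ‖ ≤ M := by
  have hcl : closure (Set.Ioo α β ×ℂ Set.Ioo 0 Real.pi) = Set.Icc α β ×ℂ Set.Icc 0 Real.pi := by
    rw [closure_reProdIm, closure_Ioo hαβ.ne, closure_Ioo Real.pi_pos.ne]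
  refine norm_le_of_forall_mem_frontier_norm_le (U := Set.Ioo α β ×ℂ Set.Ioo 0 Real.pi)
    ((Metric.isBounded_Ioo _ _).reProdIm (Metric.isBounded_Ioo _ _)) ?_ ?_ (by rwa [hcl])
  · refine DifferentiableOn.diffContOnCl ?_
    rw [hcl]
    exact hφ.differentiableOn
  · intro z hz
    have hz' : z ∈ Set.Icc α β ×ℂ Set.Icc 0 Real.pi := hcl ▸ frontier_subset_closure hz
    rw [frontier_reProdIm, frontier_Ioo hαβ, frontier_Ioo Real.pi_pos] at hz
    simp only [Set.mem_union, mem_reProdIm, Set.mem_insert_iff, Set.mem_singleton_iff] at hz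
    rcases hz with ⟨-, h | h⟩ | ⟨h | h, -⟩
    · exact hside z hz' (Or.inl h)
    · exact hside z hz' (Or.inr (Or.inl h))
    · exact hside z hz' (Or.inr (Or.inr h))
    · exact hright z hz' h

/-- The branch of `√2 (-i e^ζ)^{1/2}` which has positive real part on the strip `0 ≤ Im ζ ≤ π`. -/
noncomputable def sqrtWeight (ζ : ℂ) : ℂ :=
  (Real.sqrt 2 : ℂ) * Complex.exp ((ζ - Real.pi / 2 * Complex.I) / 2)

theorem analyticAt_sqrtWeight (ζ : ℂ) : AnalyticAt ℂ sqrtWeight ζ := by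
  unfold sqrtWeight
  fun_prop

theorem sqrtWeight_re (ζ : ℂ) :
    (sqrtWeight ζ).re = Real.sqrt 2 * Real.exp (ζ.re / 2) * Real.cos ((ζ.im - Real.pi / 2) / 2) := by
  unfold sqrtWeight
  rw [Complex.re_ofReal_mul, Complex.exp_re, mul_assoc]
  have h : (Real.pi / 2 * Complex.I : ℂ) = ((Real.pi / 2 : ℝ) : ℂ) * Complex.I := by push_cast; ring
  have h1 : ((ζ - Real.pi / 2 * Complex.I) / 2).re = ζ.re / 2 := by
    rw [h]; simp
  have h2 : ((ζ - Real.pi / 2 * Complex.I) / 2).im = (ζ.im - Real.pi / 2) / 2 := by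
    rw [h]; simp
  rw [h1, h2]

theorem sqrtWeight_re_le (ζ : ℂ) : (sqrtWeight ζ).re ≤ Real.sqrt 2 * Real.exp (ζ.re / 2) := by
  rw [sqrtWeight_re]
  exact mul_le_of_le_one_right (by positivity) (Real.cos_le_one _)

/-- The rotation by -i centres the half plane on the positive axis, so the argument of the square
root stays within π/4. There the cosine is at least √2/2, which the factor √2 normalizes to 1. -/
theorem exp_le_sqrtWeight_re {ζ : ℂ} (h0 : 0 ≤ ζ.im) (h1 : ζ.im ≤ Real.pi) :
    Real.exp (ζ.re / 2) ≤ (sqrtWeight ζ).re := by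
  rw [sqrtWeight_re]
  have hc : Real.sqrt 2 / 2 ≤ Real.cos ((ζ.im - Real.pi / 2) / 2) := by
    rw [← Real.cos_pi_div_four, ← Real.cos_abs ((ζ.im - Real.pi / 2) / 2)]
    refine Real.cos_le_cos_of_nonneg_of_le_pi (abs_nonneg _) (by linarith [Real.pi_pos]) ?_
    rw [abs_le]
    constructor <;> linarith
  have h2 : Real.sqrt 2 * Real.sqrt 2 = 2 := Real.mul_self_sqrt (by norm_num)
  have h3 := mul_le_mul_of_nonneg_left hc
    (show 0 ≤ Real.sqrt 2 * Real.exp (ζ.re / 2) by positivity)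
  nlinarith [Real.exp_pos (ζ.re / 2)]

/-- A Borel–Carathéodory estimate on a rectangle: a bound for the real part on the right side and
for the modulus on the three other sides gives a bound for the modulus away from the right side. -/
theorem norm_le_four_mul_of_re_le {H : ℂ → ℂ} {α β A : ℝ} (hαβ : α < β) (hA : 0 < A)
    (hH : AnalyticOnNhd ℂ H (Set.Icc α β ×ℂ Set.Icc 0 Real.pi))
    (hside : ∀ ζ ∈ Set.Icc α β ×ℂ Set.Icc 0 Real.pi,
      (ζ.im = 0 ∨ ζ.im = Real.pi ∨ ζ.re = α) → ‖H ζ‖ ≤ A / 4)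
    (hright : ∀ ζ ∈ Set.Icc α β ×ℂ Set.Icc 0 Real.pi, ζ.re = β → (H ζ).re ≤ A)
    {ζ : ℂ} (hζ : ζ ∈ Set.Icc α β ×ℂ Set.Icc 0 Real.pi) (hζβ : ζ.re ≤ β - Real.log 8) :
    ‖H ζ‖ ≤ 4 * A := by
  -- The maximum principle for exp H carries the one-sided bound from the boundary to the whole
  -- rectangle.
  have hre : ∀ z ∈ Set.Icc α β ×ℂ Set.Icc 0 Real.pi, (H z).re ≤ A := by
    intro z hz
    have := norm_le_of_norm_le_sides (φ := fun z => Complex.exp (H z)) (M := Real.exp A) hαβ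
      (fun w hw => (hH w hw).cexp) ?_ ?_ hz
    · simpa [Complex.norm_exp] using this
    · intro w hw hw'
      simp only [Complex.norm_exp, Real.exp_le_exp]
      linarith [Complex.re_le_norm (H w), hside w hw hw']
    · intro w hw hw'
      simpa [Complex.norm_exp] using hright w hw hw'
  have hden : ∀ z ∈ Set.Icc α β ×ℂ Set.Icc 0 Real.pi, A ≤ (2 * A - H z).re := by
    intro z hz
    have := hre z hz
    simp
    linarith
  have hne : ∀ z ∈ Set.Icc α β ×ℂ Set.Icc 0 Real.pi, 2 * A - H z ≠ 0 := by
    intro z hz h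
    have := hden z hz
    rw [h] at this
    simp at this
    linarith
  have hle : ∀ z ∈ Set.Icc α β ×ℂ Set.Icc 0 Real.pi, ‖H z‖ ≤ ‖2 * A - H z‖ := by
    intro z hz
    have h1 := hre z hz
    rw [← sq_le_sq₀ (norm_nonneg _) (norm_nonneg _), ← Complex.normSq_eq_norm_sq,
      ← Complex.normSq_eq_norm_sq, Complex.normSq_apply, Complex.normSq_apply]
    simp
    nlinarith
  -- The quotient H / (2A - H) has modulus at most 1 wherever Re H ≤ A, and at most (1/4)/(7/4) =
  -- 1/7 on the three good sides. The exponential factor is at most 1 on the right side and at most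
  -- e < 7 elsewhere.
  have key : ‖H ζ / (2 * A - H ζ) * Complex.exp (1 - sqrtWeight (ζ - β))‖ ≤ 1 := by
    refine norm_le_of_norm_le_sides
      (φ := fun z => H z / (2 * A - H z) * Complex.exp (1 - sqrtWeight (z - β))) hαβ ?_ ?_ ?_ hζ
    · intro z hz
      have hw : AnalyticAt ℂ (fun z => sqrtWeight (z - β)) z := by
        unfold sqrtWeight
        fun_prop
      exact ((hH z hz).div (analyticAt_const.sub (hH z hz)) (hne z hz)).mul
        (analyticAt_const.sub hw).cexp
    · intro z hz hz'
      have h1 := hside z hz hz'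
      have h2 : 7 / 4 * A ≤ ‖2 * A - H z‖ := by
        have h3 : ‖(2 * A : ℂ)‖ = 2 * A := by
          simp [abs_of_pos hA]
        have := norm_sub_norm_le (2 * A : ℂ) (H z)
        linarith
      have h4 : ‖H z / (2 * A - H z)‖ ≤ 1 / 7 := by
        rw [norm_div, div_le_iff₀ (by linarith)]
        linarith
      have h5 : ‖Complex.exp (1 - sqrtWeight (z - β))‖ ≤ Real.exp 1 := by
        rw [Complex.norm_exp, Real.exp_le_exp]
        have := exp_le_sqrtWeight_re (ζ := z - β) (by simpa using hz.2.1) (by simpa using hz.2.2)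
        have := Real.exp_pos ((z - β).re / 2)
        rw [Complex.sub_re, Complex.one_re]
        linarith
      rw [norm_mul]
      have := Real.exp_one_lt_d9
      nlinarith [norm_nonneg (H z / (2 * A - H z)),
        norm_nonneg (Complex.exp (1 - sqrtWeight (z - β)))]
    · intro z hz hz'
      rw [norm_mul, norm_div]
      refine mul_le_one₀ (div_le_one_of_le₀ (hle z hz) (norm_nonneg _)) (norm_nonneg _) ?_
      rw [Complex.norm_exp, Real.exp_le_one_iff]
      have := exp_le_sqrtWeight_re (ζ := z - β) (by simpa using hz.2.1) (by simpa using hz.2.2)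
      rw [Complex.sub_re, Complex.ofReal_re, hz', sub_self, zero_div, Real.exp_zero] at this
      rw [Complex.sub_re, Complex.one_re]
      linarith
  -- The shift log 8 makes the upper bound √2 · 8^(-1/2) equal to 1/2. The exponential factor is
  -- then at least 3/2, so the quotient is at most 2/3, and |H| ≤ (2/3)(2A + |H|) gives 4A.
  have hw : (sqrtWeight (ζ - β)).re ≤ 1 / 2 := by
    refine (sqrtWeight_re_le _).trans ?_
    have h1 : (ζ - β).re / 2 ≤ -(Real.log 8 / 2) := by
      rw [Complex.sub_re, Complex.ofReal_re]; linarith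
    have h2 : Real.exp (-(Real.log 8 / 2)) = (Real.sqrt 8)⁻¹ := by
      rw [Real.exp_neg, ← Real.log_sqrt (by norm_num), Real.exp_log (by positivity)]
    have h3 : Real.sqrt 8 = Real.sqrt 2 * 2 := by
      rw [show (8 : ℝ) = 2 * 2 ^ 2 by norm_num, Real.sqrt_mul (by norm_num),
        Real.sqrt_sq (by norm_num)]
    calc Real.sqrt 2 * Real.exp ((ζ - β).re / 2)
        ≤ Real.sqrt 2 * Real.exp (-(Real.log 8 / 2)) := by gcongr
      _ = 1 / 2 := by
        rw [h2, h3]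
        have : Real.sqrt 2 ≠ 0 := by positivity
        field_simp
  have hexp : 3 / 2 ≤ ‖Complex.exp (1 - sqrtWeight (ζ - β))‖ := by
    rw [Complex.norm_exp, Complex.sub_re, Complex.one_re]
    have := Real.add_one_le_exp (1 - (sqrtWeight (ζ - β)).re)
    linarith
  rw [norm_mul] at key
  have hq : ‖H ζ / (2 * A - H ζ)‖ ≤ 2 / 3 := by
    nlinarith [norm_nonneg (H ζ / (2 * A - H ζ))]
  have hpos : 0 < ‖2 * A - H ζ‖ := norm_pos_iff.2 (hne ζ hζ)
  rw [norm_div, div_le_iff₀ hpos] at hq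
  have htri : ‖2 * A - H ζ‖ ≤ 2 * A + ‖H ζ‖ := by
    refine (norm_sub_le _ _).trans_eq ?_
    simp [abs_of_pos hA]
  linarith

/-- A Phragmén–Lindelöf estimate on a rectangle. -/
theorem norm_le_mul_exp_of_norm_le {H : ℂ → ℂ} {α β σ K M ε : ℝ} (hα : 0 ≤ α) (hαβ : α < β)
    (hσ : 0 ≤ σ) (hK : 0 ≤ K) (hε : 0 ≤ ε)
    (hH : AnalyticOnNhd ℂ H (Set.Icc α β ×ℂ Set.Icc 0 Real.pi))
    (hside : ∀ ζ ∈ Set.Icc α β ×ℂ Set.Icc 0 Real.pi,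
      (ζ.im = 0 ∨ ζ.im = Real.pi ∨ ζ.re = α) → ‖H ζ‖ ≤ K * Real.exp (σ * ζ.re))
    (hright : ∀ ζ ∈ Set.Icc α β ×ℂ Set.Icc 0 Real.pi, ζ.re = β → ‖H ζ‖ ≤ M)
    (hM : M * Real.exp (-(ε * Real.exp (β / 2))) ≤ K)
    {ζ : ℂ} (hζ : ζ ∈ Set.Icc α β ×ℂ Set.Icc 0 Real.pi) :
    ‖H ζ‖ ≤ K * Real.exp (σ * ζ.re) * Real.exp (ε * (Real.sqrt 2 * Real.exp (ζ.re / 2))) := by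
  have hnorm : ∀ z : ℂ, ‖H z * Complex.exp (-(σ * z) - ε * sqrtWeight z)‖ =
      ‖H z‖ * (Real.exp (-(σ * z.re)) * Real.exp (-(ε * (sqrtWeight z).re))) := by
    intro z
    rw [norm_mul, Complex.norm_exp, ← Real.exp_add]
    simp [sub_eq_add_neg]
  -- The factor exp(-σζ) is z^(-σ) and normalizes the bound on the three sides; the weight of order
  -- 1/2 in z is needed only on the right side, where it offsets M.
  have key : ‖H ζ * Complex.exp (-(σ * ζ) - ε * sqrtWeight ζ)‖ ≤ K := by
    refine norm_le_of_norm_le_sides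
      (φ := fun z => H z * Complex.exp (-(σ * z) - ε * sqrtWeight z)) hαβ ?_ ?_ ?_ hζ
    · intro z hz
      have h1 := hH z hz
      have h2 := analyticAt_sqrtWeight z
      fun_prop
    · intro z hz hz'
      rw [hnorm]
      have h1 : Real.exp (-(ε * (sqrtWeight z).re)) ≤ 1 := by
        rw [Real.exp_le_one_iff]
        have := exp_le_sqrtWeight_re hz.2.1 hz.2.2
        have := Real.exp_pos (z.re / 2)
        have : 0 ≤ (sqrtWeight z).re := by linarith
        have := mul_nonneg hε this
        linarith
      calc ‖H z‖ * (Real.exp (-(σ * z.re)) * Real.exp (-(ε * (sqrtWeight z).re)))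
          ≤ (K * Real.exp (σ * z.re)) * (Real.exp (-(σ * z.re)) * 1) := by
            gcongr
            exact hside z hz hz'
        _ = K := by rw [mul_one, mul_assoc, ← Real.exp_add]; simp
    · intro z hz hz'
      rw [hnorm]
      have hM0 : ‖H z‖ ≤ M := hright z hz hz'
      have h1 : Real.exp (-(σ * z.re)) ≤ 1 := by
        rw [Real.exp_le_one_iff]
        have : 0 ≤ z.re := hα.trans hz.1.1
        have := mul_nonneg hσ this
        linarith
      have h2 := exp_le_sqrtWeight_re hz.2.1 hz.2.2
      calc ‖H z‖ * (Real.exp (-(σ * z.re)) * Real.exp (-(ε * (sqrtWeight z).re)))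
          ≤ M * (1 * Real.exp (-(ε * Real.exp (z.re / 2)))) := by
            gcongr
            exact (norm_nonneg _).trans hM0
        _ ≤ K := by rw [one_mul, hz']; exact hM
  rw [hnorm] at key
  have hle := mul_le_mul_of_nonneg_left (sqrtWeight_re_le ζ) hε
  have h3 : Real.exp (-(ε * (Real.sqrt 2 * Real.exp (ζ.re / 2)))) ≤
      Real.exp (-(ε * (sqrtWeight ζ).re)) := by
    rw [Real.exp_le_exp]; linarith
  have h4 : ‖H ζ‖ * (Real.exp (-(σ * ζ.re)) *
      Real.exp (-(ε * (Real.sqrt 2 * Real.exp (ζ.re / 2))))) ≤ K :=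
    (by gcongr : _ ≤ _).trans key
  rw [Real.exp_neg, Real.exp_neg] at h4
  have e1 := Real.exp_pos (σ * ζ.re)
  have e2 := Real.exp_pos (ε * (Real.sqrt 2 * Real.exp (ζ.re / 2)))
  rw [← mul_inv, ← div_eq_mul_inv, div_le_iff₀ (by positivity)] at h4
  linarith

/-- Functions on an unbounded family of rectangles, with uniform bounds on three sides and a
one-sided bound of finite order on the right side, are bounded uniformly. -/
theorem norm_le_of_strip_family {α σ K C m : ℝ} (hα : 0 ≤ α) (hσ : 0 ≤ σ) (hK : 0 < K)
    (hC : 0 < C) (hσm : σ ≤ m) (hKC : 4 * K ≤ C)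
    {ζ : ℂ} (hζ : α ≤ ζ.re) (hζ0 : 0 ≤ ζ.im) (hζ1 : ζ.im ≤ Real.pi) :
    ∃ β₀, ∀ β ≥ β₀, ∀ H : ℂ → ℂ, AnalyticOnNhd ℂ H (Set.Icc α β ×ℂ Set.Icc 0 Real.pi) →
      (∀ z ∈ Set.Icc α β ×ℂ Set.Icc 0 Real.pi,
        (z.im = 0 ∨ z.im = Real.pi ∨ z.re = α) → ‖H z‖ ≤ K * Real.exp (σ * z.re)) →
      (∀ z ∈ Set.Icc α β ×ℂ Set.Icc 0 Real.pi, z.re = β → (H z).re ≤ C * Real.exp (m * β)) →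
      ‖H ζ‖ ≤ K * Real.exp 1 * Real.exp (σ * ζ.re) := by
  -- With this ε, which depends on ζ but not on β, removing the weight at ζ costs a factor of at
  -- most e.
  set ε : ℝ := (Real.sqrt 2 * Real.exp (ζ.re / 2))⁻¹ with hε
  have hε0 : 0 < ε := by positivity
  have hlog : 0 < Real.log 8 := Real.log_pos (by norm_num)
  have hev : ∀ᶠ β : ℝ in Filter.atTop,
      4 * (C * Real.exp (m * β)) * Real.exp (-(ε * Real.exp ((β - Real.log 8) / 2))) ≤ K := by
    -- With x = exp((β - log 8)/2), the Borel–Carathéodory bound is a constant times x^(2m), so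
    -- exp(-εx) beats it.
    have h0 : Filter.Tendsto (fun x : ℝ => x ^ (2 * m) * Real.exp (-ε * x)) Filter.atTop
        (nhds 0) := tendsto_rpow_mul_exp_neg_mul_atTop_nhds_zero _ _ hε0
    have h1 : Filter.Tendsto (fun β : ℝ => Real.exp ((β - Real.log 8) / 2)) Filter.atTop
        Filter.atTop := by
      refine Real.tendsto_exp_atTop.comp ?_
      refine Filter.Tendsto.atTop_div_const (by norm_num) ?_
      exact Filter.tendsto_atTop_add_const_right _ _ Filter.tendsto_id
    have h2 := (h0.comp h1).const_mul (4 * C * Real.exp (m * Real.log 8))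
    rw [mul_zero] at h2
    filter_upwards [h2.eventually_lt_const hK] with β hβ
    refine le_trans (le_of_eq ?_) hβ.le
    simp only [Function.comp]
    rw [← Real.exp_mul, show m * β = m * Real.log 8 + (β - Real.log 8) / 2 * (2 * m) by ring,
      Real.exp_add, neg_mul]
    ring
  obtain ⟨β₁, hβ₁⟩ := Filter.eventually_atTop.1 hev
  refine ⟨max β₁ (ζ.re + Real.log 8 + 1), fun β hβ H hH hside hright => ?_⟩
  have hβ1 : β₁ ≤ β := le_trans (le_max_left _ _) hβ
  have hβ2 : ζ.re + Real.log 8 + 1 ≤ β := le_trans (le_max_right _ _) hβ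
  have hαβ : α < β := by linarith
  have hsub : Set.Icc α (β - Real.log 8) ×ℂ Set.Icc 0 Real.pi ⊆
      Set.Icc α β ×ℂ Set.Icc 0 Real.pi := by
    rintro z ⟨⟨h1, h2⟩, h3⟩
    exact ⟨⟨h1, by linarith⟩, h3⟩
  have hBC : ∀ z ∈ Set.Icc α β ×ℂ Set.Icc 0 Real.pi, z.re ≤ β - Real.log 8 →
      ‖H z‖ ≤ 4 * (C * Real.exp (m * β)) := by
    intro z hz hz'
    refine norm_le_four_mul_of_re_le hαβ (by positivity) hH ?_ hright hz hz'
    intro w hw hw'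
    refine (hside w hw hw').trans ?_
    have hwβ : w.re ≤ β := hw.1.2
    have hw0 : 0 ≤ w.re := hα.trans hw.1.1
    have : σ * w.re ≤ m * β := by
      have := mul_le_mul hσm hwβ hw0 (hσ.trans hσm)
      linarith
    have h2 := Real.exp_le_exp.2 this
    have := Real.exp_pos (σ * w.re)
    nlinarith
  have := norm_le_mul_exp_of_norm_le (β := β - Real.log 8) (ζ := ζ) hα (by linarith) hσ hK.le
    hε0.le (fun z hz => hH z (hsub hz)) (fun z hz => hside z (hsub hz))
    (fun z hz hz' => hBC z (hsub hz) hz'.le) (hβ₁ β hβ1) ⟨⟨hζ, by linarith⟩, hζ0, hζ1⟩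
  rw [hε, inv_mul_cancel₀ (by positivity)] at this
  linarith

/-! ### Sums over zeros with a counting function of order σ -/

/-- Partial sums of `m / u ^ j` for a counting function of order `σ > j`. -/
theorem sum_div_pow_le_of_count_le {ι : Type*} (s : Finset ι) (u m : ι → ℝ) {N σ : ℝ} {j : ℕ}
    (hu : ∀ i ∈ s, 1 ≤ u i) (hm : ∀ i ∈ s, 0 ≤ m i) (hN : 0 ≤ N) (hj : (j : ℝ) < σ)
    (hc : ∀ r : ℝ, 1 ≤ r → ∑ i ∈ s with u i ≤ r, m i ≤ N * r ^ σ) {r : ℝ} (hr : 0 < r) :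
    ∑ i ∈ s with u i ≤ r, m i / u i ^ j ≤
      N * 2 ^ j / (1 - 2 ^ (-(σ - j))) * r ^ (σ - j) := by
  have hq1 : (2 : ℝ) ^ (-(σ - j)) < 1 := Real.rpow_lt_one_of_one_lt_of_neg (by norm_num) (by linarith)
  set q : ℝ := (2 : ℝ) ^ (-(σ - j)) with hq
  set D : ℝ := N * 2 ^ j / (1 - q) with hD
  have hD0 : 0 ≤ D := div_nonneg (by positivity) (by linarith)
  -- The constant D is the fixed point of the dyadic recursion: passing from r/2 to r multiplies the
  -- old bound by q and adds the block r/2 < u ≤ r.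
  have hDeq : D * q + N * 2 ^ j = D := by
    have : 1 - q ≠ 0 := by linarith
    rw [hD]; field_simp; ring
  obtain ⟨k, hk⟩ := pow_unbounded_of_one_lt r (by norm_num : (1 : ℝ) < 2)
  induction k generalizing r with
  | zero =>
    rw [Finset.sum_eq_zero]
    · positivity
    · intro i hi
      rw [Finset.mem_filter] at hi
      have := hu i hi.1
      simp at hk
      linarith
  | succ k ih =>
    by_cases hr1 : r < 1
    · rw [Finset.sum_eq_zero]
      · positivity
      · intro i hi
        rw [Finset.mem_filter] at hi
        have := hu i hi.1
        linarith
    push Not at hr1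
    have hih := ih (r := r / 2) (by positivity) (by rw [pow_succ] at hk; linarith)
    have hsplit : ∑ i ∈ s with u i ≤ r, m i / u i ^ j ≤
        ∑ i ∈ s with u i ≤ r / 2, m i / u i ^ j + ∑ i ∈ s with u i ≤ r, m i / (r / 2) ^ j := by
      rw [Finset.sum_filter, Finset.sum_filter, Finset.sum_filter, ← Finset.sum_add_distrib]
      refine Finset.sum_le_sum fun i hi => ?_
      have h1 := hu i hi
      have h2 := hm i hi
      by_cases ha : u i ≤ r / 2
      · have hb : u i ≤ r := by linarith
        simp only [if_pos ha, if_pos hb]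
        have : 0 ≤ m i / (r / 2) ^ j := by positivity
        linarith
      · rw [if_neg ha]
        by_cases hb : u i ≤ r
        · rw [if_pos hb, if_pos hb, zero_add]
          push Not at ha
          gcongr
        · rw [if_neg hb, if_neg hb, zero_add]
    have hlast : ∑ i ∈ s with u i ≤ r, m i / (r / 2) ^ j ≤ N * 2 ^ j * r ^ (σ - j) := by
      rw [← Finset.sum_div, div_le_iff₀ (by positivity)]
      refine (hc r hr1).trans_eq ?_
      rw [Real.rpow_sub hr, Real.rpow_natCast, div_pow]
      field_simp
    have hhalf : (r / 2) ^ (σ - j) = q * r ^ (σ - j) := by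
      rw [Real.div_rpow hr.le (by norm_num), hq, Real.rpow_neg (by norm_num)]
      ring
    rw [hhalf] at hih
    calc _ ≤ _ := hsplit
      _ ≤ D * (q * r ^ (σ - j)) + N * 2 ^ j * r ^ (σ - j) := add_le_add hih hlast
      _ = (D * q + N * 2 ^ j) * r ^ (σ - j) := by ring
      _ = D * r ^ (σ - j) := by rw [hDeq]

/-- Tails of `∑ m / u ^ q` for a counting function of order `σ < q`. -/
theorem sum_tail_div_pow_le_of_count_le {ι : Type*} (s : Finset ι) (u m : ι → ℝ) {N σ : ℝ} {q : ℕ}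
    (hm : ∀ i ∈ s, 0 ≤ m i) (hN : 0 ≤ N) (hq : σ < q)
    (hc : ∀ r : ℝ, 1 ≤ r → ∑ i ∈ s with u i ≤ r, m i ≤ N * r ^ σ) {r : ℝ} (hr : 1 ≤ r) :
    ∑ i ∈ s with r < u i, m i / u i ^ q ≤
      N * 2 ^ σ / (1 - 2 ^ (σ - q)) * r ^ (σ - q) := by
  have hθ1 : (2 : ℝ) ^ (σ - q) < 1 := Real.rpow_lt_one_of_one_lt_of_neg (by norm_num) (by linarith)
  set θ : ℝ := (2 : ℝ) ^ (σ - q) with hθ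
  set D : ℝ := N * 2 ^ σ / (1 - θ) with hD
  have hD0 : 0 ≤ D := div_nonneg (by positivity) (by linarith)
  have hDeq : N * 2 ^ σ + D * θ = D := by
    have : 1 - θ ≠ 0 := by linarith
    rw [hD]; field_simp; ring
  -- Here the induction doubles r until the finite family is exhausted; the tail is then empty.
  obtain ⟨k, hk⟩ : ∃ k : ℕ, ∀ i ∈ s, u i ≤ r * 2 ^ k := by
    obtain ⟨k, hk⟩ := pow_unbounded_of_one_lt (∑ i ∈ s, |u i|) (by norm_num : (1 : ℝ) < 2)
    refine ⟨k, fun i hi => ?_⟩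
    have h1 := Finset.single_le_sum (f := fun i => |u i|) (fun i _ => abs_nonneg _) hi
    have h2 := le_abs_self (u i)
    have h3 : (2 : ℝ) ^ k ≤ r * 2 ^ k := le_mul_of_one_le_left (by positivity) hr
    linarith
  induction k generalizing r with
  | zero =>
    rw [Finset.sum_eq_zero]
    · positivity
    · intro i hi
      rw [Finset.mem_filter] at hi
      have := hk i hi.1
      simp at this
      linarith
  | succ k ih =>
    have hr0 : 0 < r := by linarith
    have hih := ih (r := 2 * r) (by linarith) (fun i hi => (hk i hi).trans_eq (by ring))
    have hsplit : ∑ i ∈ s with r < u i, m i / u i ^ q ≤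
        ∑ i ∈ s with u i ≤ 2 * r, m i / r ^ q + ∑ i ∈ s with 2 * r < u i, m i / u i ^ q := by
      rw [Finset.sum_filter, Finset.sum_filter, Finset.sum_filter, ← Finset.sum_add_distrib]
      refine Finset.sum_le_sum fun i hi => ?_
      have h2 := hm i hi
      have h3 : 0 ≤ m i / r ^ q := by positivity
      by_cases ha : u i ≤ 2 * r
      · rw [if_pos ha, if_neg (not_lt.2 ha), add_zero]
        split_ifs with hb
        · gcongr
        · exact h3
      · push Not at ha
        rw [if_neg (not_le.2 ha), if_pos ha, if_pos (by linarith), zero_add]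
    have hfirst : ∑ i ∈ s with u i ≤ 2 * r, m i / r ^ q ≤ N * 2 ^ σ * r ^ (σ - q) := by
      rw [← Finset.sum_div, div_le_iff₀ (by positivity)]
      refine (hc (2 * r) (by linarith)).trans_eq ?_
      rw [Real.rpow_sub hr0, Real.rpow_natCast, Real.mul_rpow (by norm_num) hr0.le]
      field_simp
    have hdouble : (2 * r) ^ (σ - q) = θ * r ^ (σ - q) := by
      rw [Real.mul_rpow (by norm_num) hr0.le]
    rw [hdouble] at hih
    calc _ ≤ _ := hsplit
      _ ≤ N * 2 ^ σ * r ^ (σ - q) + D * (θ * r ^ (σ - q)) := add_le_add hfirst hih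
      _ = (N * 2 ^ σ + D * θ) * r ^ (σ - q) := by ring
      _ = D * r ^ (σ - q) := by rw [hDeq]

/-- The size of the logarithm of a primary factor of genus `p` at distance ratio `t`, up to
a constant factor. -/
noncomputable def genusWeight (p : ℕ) (t : ℝ) : ℝ :=
  if 1 / 2 < t then 1 + ∑ j ∈ Finset.range p, t ^ (j + 1) else t ^ (p + 1)

/-- The weighted sum over a sequence with counting function of order `σ` is of order `σ`, provided
that no integer lies between the genus and `σ`, apart from `σ = 0`. -/
theorem exists_sum_genusWeight_le {N σ : ℝ} (p : ℕ) (hN : 0 ≤ N)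
    (hp : ∀ j : ℕ, 1 ≤ j → j ≤ p → (j : ℝ) < σ) (hσp : σ < p + 1) :
    ∃ K : ℝ, 0 < K ∧ ∀ {ι : Type} (s : Finset ι) (u m : ι → ℝ), (∀ i ∈ s, 1 ≤ u i) →
      (∀ i ∈ s, 0 ≤ m i) →
      (∀ r : ℝ, 1 ≤ r → ∑ i ∈ s with u i ≤ r, m i ≤ N * r ^ σ) →
      ∀ r : ℝ, 1 ≤ r → ∑ i ∈ s, m i * genusWeight p (r / u i) ≤ K * r ^ σ := by
  set D : ℕ → ℝ := fun j => N * 2 ^ j / (1 - 2 ^ (-(σ - j))) with hD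
  set E : ℝ := N * 2 ^ σ / (1 - 2 ^ (σ - (p + 1 : ℕ))) with hE
  have hσp' : σ < (p + 1 : ℕ) := by push_cast; exact hσp
  have hD0 : ∀ j ∈ Finset.range p, 0 ≤ D (j + 1) := by
    intro j hj
    have := hp (j + 1) (by omega) (by have := Finset.mem_range.1 hj; omega)
    have h1 : (2 : ℝ) ^ (-(σ - (j + 1 : ℕ))) < 1 :=
      Real.rpow_lt_one_of_one_lt_of_neg (by norm_num) (by linarith)
    exact div_nonneg (by positivity) (by linarith)
  have hE0 : 0 ≤ E := by
    have h1 : (2 : ℝ) ^ (σ - (p + 1 : ℕ)) < 1 :=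
      Real.rpow_lt_one_of_one_lt_of_neg (by norm_num) (by linarith)
    exact div_nonneg (by positivity) (by linarith)
  refine ⟨N * 2 ^ σ + ∑ j ∈ Finset.range p, D (j + 1) * 2 ^ (σ - (j + 1 : ℕ)) + E + 1, ?_, ?_⟩
  · have := Finset.sum_nonneg (s := Finset.range p)
      (f := fun j => D (j + 1) * 2 ^ (σ - (j + 1 : ℕ)))
      fun j hj => mul_nonneg (hD0 j hj) (by positivity)
    positivity
  intro ι s u m hu hm hc r hr
  have hr0 : 0 < r := by linarith
  -- Near terms have u ≤ 2r and far terms have u ≥ 2r. Starting the far sum already at r < u counts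
  -- some terms twice, which is harmless because all terms are nonnegative.
  have hsplit : ∑ i ∈ s, m i * genusWeight p (r / u i) ≤
      ∑ i ∈ s with u i ≤ 2 * r, m i +
      ∑ j ∈ Finset.range p, r ^ (j + 1) * ∑ i ∈ s with u i ≤ 2 * r, m i / u i ^ (j + 1) +
      r ^ (p + 1) * ∑ i ∈ s with r < u i, m i / u i ^ (p + 1) := by
    simp_rw [Finset.mul_sum, Finset.sum_filter]
    rw [Finset.sum_comm, ← Finset.sum_add_distrib, ← Finset.sum_add_distrib]
    refine Finset.sum_le_sum fun i hi => ?_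
    have h1 := hu i hi
    have h2 := hm i hi
    have h0 : 0 < u i := by linarith
    unfold genusWeight
    by_cases ha : 1 / 2 < r / u i
    · have hb : u i ≤ 2 * r := by
        rw [lt_div_iff₀ h0] at ha; linarith
      simp only [if_pos ha, if_pos hb, mul_add, mul_one, Finset.mul_sum]
      have h4 : 0 ≤ if r < u i then r ^ (p + 1) * (m i / u i ^ (p + 1)) else 0 := by
        split_ifs <;> positivity
      have h5 : ∀ j, m i * (r / u i) ^ (j + 1) = r ^ (j + 1) * (m i / u i ^ (j + 1)) := by
        intro j; rw [div_pow]; ring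
      simp only [h5]
      rw [← mul_ite_zero]
      simp at h4 ⊢
      linarith
    · have hb : r < u i := by
        rw [not_lt, div_le_iff₀ h0] at ha; linarith
      rw [if_neg ha, if_pos hb]
      have h5 : m i * (r / u i) ^ (p + 1) = r ^ (p + 1) * (m i / u i ^ (p + 1)) := by
        rw [div_pow]; ring
      rw [h5]
      have h6 : 0 ≤ if u i ≤ 2 * r then m i else 0 := by split_ifs <;> positivity
      have h7 : 0 ≤ ∑ j ∈ Finset.range p,
          if u i ≤ 2 * r then r ^ (j + 1) * (m i / u i ^ (j + 1)) else 0 :=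
        Finset.sum_nonneg fun j _ => by split_ifs <;> positivity
      linarith
  have h1 : ∑ i ∈ s with u i ≤ 2 * r, m i ≤ N * 2 ^ σ * r ^ σ := by
    refine (hc (2 * r) (by linarith)).trans_eq ?_
    rw [Real.mul_rpow (by norm_num) hr0.le]; ring
  have h2 : ∑ j ∈ Finset.range p, r ^ (j + 1) * ∑ i ∈ s with u i ≤ 2 * r, m i / u i ^ (j + 1) ≤
      (∑ j ∈ Finset.range p, D (j + 1) * 2 ^ (σ - (j + 1 : ℕ))) * r ^ σ := by
    rw [Finset.sum_mul]
    refine Finset.sum_le_sum fun j hj => ?_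
    have hjσ := hp (j + 1) (by omega) (by have := Finset.mem_range.1 hj; omega)
    have := sum_div_pow_le_of_count_le s u m hu hm hN hjσ hc (r := 2 * r) (by linarith)
    calc _ ≤ r ^ (j + 1) * (D (j + 1) * (2 * r) ^ (σ - (j + 1 : ℕ))) := by gcongr
      _ = _ := by
        rw [Real.mul_rpow (by norm_num) hr0.le, Real.rpow_sub hr0, Real.rpow_natCast]
        field_simp
  have h3 : r ^ (p + 1) * ∑ i ∈ s with r < u i, m i / u i ^ (p + 1) ≤ E * r ^ σ := by
    have := sum_tail_div_pow_le_of_count_le s u m hm hN hσp' hc hr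
    calc _ ≤ r ^ (p + 1) * (E * r ^ (σ - (p + 1 : ℕ))) := by gcongr
      _ = _ := by
        rw [Real.rpow_sub hr0, Real.rpow_natCast]
        field_simp
  have h4 : 0 ≤ r ^ σ := by positivity
  linarith

/-! ### Blaschke factors of genus p for the upper half plane -/

/-- The truncation `∑_{j=1}^p w^j / j` of the power series of `-log (1 - w)`. -/
noncomputable def truncLog (p : ℕ) (w : ℂ) : ℂ :=
  ∑ j ∈ Finset.range p, w ^ (j + 1) / (j + 1)

theorem norm_truncLog_le (p : ℕ) (w : ℂ) :
    ‖truncLog p w‖ ≤ ∑ j ∈ Finset.range p, ‖w‖ ^ (j + 1) := by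
  refine (norm_sum_le _ _).trans (Finset.sum_le_sum fun j _ => ?_)
  rw [norm_div, norm_pow]
  refine div_le_self (by positivity) ?_
  rw [show ((j : ℂ) + 1) = ((j + 1 : ℕ) : ℂ) by push_cast; rfl, Complex.norm_natCast]
  push_cast
  linarith [(Nat.cast_nonneg j : (0 : ℝ) ≤ j)]

theorem logTaylor_neg (p : ℕ) (w : ℂ) : Complex.logTaylor (p + 1) (-w) = -truncLog p w := by
  unfold Complex.logTaylor truncLog
  rw [Finset.sum_range_succ', ← Finset.sum_neg_distrib]
  simp only [Nat.cast_zero, div_zero, add_zero]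
  refine Finset.sum_congr rfl fun j _ => ?_
  have h : ((-1 : ℂ) ^ (j + 1)) * (-1) ^ (j + 1) = 1 := by
    rw [← mul_pow]; simp
  rw [show (-w) ^ (j + 1) = (-1) ^ (j + 1) * w ^ (j + 1) by rw [← mul_pow]; simp,
    pow_succ (-1 : ℂ) (j + 1)]
  push_cast
  linear_combination (-(w ^ (j + 1) / ((j : ℂ) + 1))) * h

theorem norm_log_one_sub_add_truncLog_le (p : ℕ) {w : ℂ} (hw : ‖w‖ ≤ 1 / 2) :
    ‖Complex.log (1 - w) + truncLog p w‖ ≤ 2 * ‖w‖ ^ (p + 1) := by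
  have h := Complex.norm_log_sub_logTaylor_le p (z := -w) (by rw [norm_neg]; linarith)
  rw [logTaylor_neg, norm_neg, sub_neg_eq_add, ← sub_eq_add_neg] at h
  refine h.trans ?_
  have h1 : (1 - ‖w‖)⁻¹ ≤ 2 := by
    rw [inv_le_comm₀ (by linarith) (by norm_num)]; linarith
  calc ‖w‖ ^ (p + 1) * (1 - ‖w‖)⁻¹ / (p + 1) ≤ ‖w‖ ^ (p + 1) * (1 - ‖w‖)⁻¹ :=
        div_le_self (mul_nonneg (by positivity) (inv_nonneg.2 (by linarith)))
          (by linarith [(Nat.cast_nonneg p : (0 : ℝ) ≤ p)])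
    _ ≤ ‖w‖ ^ (p + 1) * 2 := by gcongr
    _ = _ := by ring

theorem hasDerivAt_truncLog_div (p : ℕ) {a z : ℂ} (ha : a ≠ 0) (hza : z ≠ a) :
    HasDerivAt (fun z => truncLog p (z / a)) (((z / a) ^ p - 1) / (z - a)) z := by
  have h1 : HasDerivAt (fun z => truncLog p (z / a))
      (∑ j ∈ Finset.range p, (z / a) ^ j / a) z := by
    unfold truncLog
    refine HasDerivAt.fun_sum fun j _ => ?_
    have h := (((hasDerivAt_id z).div_const a).pow (j + 1)).div_const ((j : ℂ) + 1)
    refine h.congr_deriv ?_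
    have : (j : ℂ) + 1 ≠ 0 := by exact_mod_cast Nat.succ_ne_zero j
    rw [Nat.add_sub_cancel, Nat.cast_succ, id]
    field_simp
  convert h1 using 1
  have h2 : z / a ≠ 1 := by
    rw [Ne, div_eq_one_iff_eq ha]; exact hza
  have h3 : z - a ≠ 0 := sub_ne_zero.2 hza
  have h4 : z / a - 1 ≠ 0 := sub_ne_zero.2 h2
  rw [← Finset.sum_div, geom_sum_eq h2, div_div, sub_mul, one_mul, div_mul_cancel₀ _ ha]

/-- The Blaschke factor of the upper half plane with convergence factors of genus `p`. -/
noncomputable def blaschkeFactor (p : ℕ) (a z : ℂ) : ℂ :=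
  (z - a) / (z - conj a) * Complex.exp (truncLog p (z / a) - truncLog p (z / conj a))

/-- The logarithmic derivative of `blaschkeFactor p a`. -/
noncomputable def blaschkeLogDeriv (p : ℕ) (a z : ℂ) : ℂ :=
  (z / a) ^ p / (z - a) - (z / conj a) ^ p / (z - conj a)

theorem ne_conj_of_im {a z : ℂ} (ha : 0 < a.im) (hz : 0 ≤ z.im) : z ≠ conj a := by
  intro h
  rw [h, Complex.conj_im] at hz
  linarith

theorem ne_zero_of_im_pos {a : ℂ} (ha : 0 < a.im) : a ≠ 0 := by
  rintro rfl
  simp at ha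

theorem norm_sub_le_norm_sub_conj {a z : ℂ} (ha : 0 < a.im) (hz : 0 ≤ z.im) :
    ‖z - a‖ ≤ ‖z - conj a‖ := by
  rw [← sq_le_sq₀ (norm_nonneg _) (norm_nonneg _), ← Complex.normSq_eq_norm_sq,
    ← Complex.normSq_eq_norm_sq, Complex.normSq_apply, Complex.normSq_apply]
  simp
  nlinarith [mul_nonneg ha.le hz]

theorem norm_truncLog_sub_truncLog_le (p : ℕ) (a z : ℂ) :
    ‖truncLog p (z / a) - truncLog p (z / conj a)‖ ≤
      2 * ∑ j ∈ Finset.range p, (‖z‖ / ‖a‖) ^ (j + 1) := by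
  have h1 := norm_truncLog_le p (z / a)
  have h2 := norm_truncLog_le p (z / conj a)
  rw [norm_div] at h1
  rw [norm_div, Complex.norm_conj] at h2
  linarith [norm_sub_le (truncLog p (z / a)) (truncLog p (z / conj a))]

/-- For a near zero |z - a| ≤ |z - conj a|, so only the convergence factor contributes. For a far
zero the convergence factor cancels the first p terms of the logarithm and leaves a remainder of
order p + 1. -/
theorem norm_blaschkeFactor_le (p : ℕ) {a z : ℂ} (ha : 0 < a.im) (hz : 0 ≤ z.im) :
    ‖blaschkeFactor p a z‖ ≤ Real.exp (4 * genusWeight p (‖z‖ / ‖a‖)) := by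
  have ha0 := ne_zero_of_im_pos ha
  have hac : conj a ≠ 0 := (map_ne_zero _).2 ha0
  unfold genusWeight
  split_ifs with h
  · unfold blaschkeFactor
    rw [norm_mul, norm_div, Complex.norm_exp]
    have h1 : ‖z - a‖ / ‖z - conj a‖ ≤ 1 :=
      div_le_one_of_le₀ (norm_sub_le_norm_sub_conj ha hz) (norm_nonneg _)
    have h2 := (Complex.re_le_norm _).trans (norm_truncLog_sub_truncLog_le p a z)
    have h3 : 0 ≤ ∑ j ∈ Finset.range p, (‖z‖ / ‖a‖) ^ (j + 1) := by positivity
    calc _ ≤ 1 * Real.exp (2 * ∑ j ∈ Finset.range p, (‖z‖ / ‖a‖) ^ (j + 1)) := by gcongr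
      _ ≤ _ := by rw [one_mul, Real.exp_le_exp]; linarith
  · have hw1 : ‖z / a‖ ≤ 1 / 2 := by rw [norm_div]; linarith
    have hw2 : ‖z / conj a‖ ≤ 1 / 2 := by rw [norm_div, Complex.norm_conj]; linarith
    have hne : ∀ w : ℂ, ‖w‖ ≤ 1 / 2 → 1 - w ≠ 0 := by
      intro w hw h0
      rw [← sub_eq_zero.1 h0] at hw
      norm_num at hw
    -- The constant a / conj a is unimodular, so only the two logarithmic remainders affect the
    -- modulus.
    have hb : blaschkeFactor p a z = a / conj a * Complex.exp
        ((Complex.log (1 - z / a) + truncLog p (z / a)) -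
          (Complex.log (1 - z / conj a) + truncLog p (z / conj a))) := by
      have h1 : z - a ≠ 0 := by
        intro h0; apply hne _ hw1; rw [sub_eq_zero.1 h0, div_self ha0, sub_self]
      have h2 : z - conj a ≠ 0 := sub_ne_zero.2 (ne_conj_of_im ha hz)
      rw [add_sub_add_comm, Complex.exp_add, Complex.exp_sub, Complex.exp_log (hne _ hw1),
        Complex.exp_log (hne _ hw2), ← mul_assoc, blaschkeFactor]
      congr 1
      have e1 : 1 - z / a = -(z - a) / a := by field_simp; ring
      have e2 : 1 - z / conj a = -(z - conj a) / conj a := by field_simp; ring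
      rw [e1, e2]
      field_simp
    have h1 := norm_log_one_sub_add_truncLog_le p hw1
    have h2 := norm_log_one_sub_add_truncLog_le p hw2
    rw [norm_div] at h1
    rw [norm_div, Complex.norm_conj] at h2
    rw [hb, norm_mul, norm_div, Complex.norm_conj, div_self (norm_ne_zero_iff.2 ha0), one_mul,
      Complex.norm_exp, Real.exp_le_exp]
    refine (Complex.re_le_norm _).trans ((norm_sub_le _ _).trans ?_)
    linarith

theorem le_norm_blaschkeFactor (p : ℕ) {a z : ℂ} {δ : ℝ} (ha : 0 < a.im) (hz : 0 ≤ z.im)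
    (_hδ : 0 ≤ δ) (hza : δ ≤ ‖z - a‖) (hnear : 1 / 2 < ‖z‖ / ‖a‖) :
    δ / (‖z‖ + ‖a‖) * Real.exp (-(4 * genusWeight p (‖z‖ / ‖a‖))) ≤ ‖blaschkeFactor p a z‖ := by
  unfold genusWeight blaschkeFactor
  rw [if_pos hnear, norm_mul, norm_div, Complex.norm_exp]
  have h1 : ‖z - conj a‖ ≤ ‖z‖ + ‖a‖ := by
    have := norm_sub_le z (conj a)
    rwa [Complex.norm_conj] at this
  have h2 := (Complex.abs_re_le_norm _).trans (norm_truncLog_sub_truncLog_le p a z)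
  have h3 : 0 ≤ ∑ j ∈ Finset.range p, (‖z‖ / ‖a‖) ^ (j + 1) := by positivity
  have h4 : 0 < ‖z - conj a‖ := norm_pos_iff.2 (sub_ne_zero.2 (ne_conj_of_im ha hz))
  gcongr
  linarith [(abs_le.1 h2).1]

/-- For real x the two truncated logarithms are conjugate, so the exponent is purely imaginary. -/
theorem norm_blaschkeFactor_ofReal (p : ℕ) {a : ℂ} (ha : 0 < a.im) (x : ℝ) :
    ‖blaschkeFactor p a x‖ = 1 := by
  have ha0 := ne_zero_of_im_pos ha
  have hne : ‖(x : ℂ) - conj a‖ ≠ 0 :=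
    norm_ne_zero_iff.2 (sub_ne_zero.2 (ne_conj_of_im ha (by simp)))
  have h1 : ‖(x : ℂ) - a‖ = ‖(x : ℂ) - conj a‖ := by
    rw [← Complex.norm_conj ((x : ℂ) - a), map_sub, Complex.conj_ofReal]
  have h2 : truncLog p (x / conj a) = conj (truncLog p (x / a)) := by
    unfold truncLog
    simp [map_sum]
  unfold blaschkeFactor
  rw [norm_mul, norm_div, h1, div_self hne, one_mul, Complex.norm_exp, h2, Complex.sub_re,
    Complex.conj_re, sub_self, Real.exp_zero]

theorem hasDerivAt_blaschkeFactor (p : ℕ) {a z : ℂ} (ha : 0 < a.im) (hz : 0 ≤ z.im)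
    (hza : z ≠ a) :
    HasDerivAt (blaschkeFactor p a) (blaschkeFactor p a z * blaschkeLogDeriv p a z) z := by
  have ha0 := ne_zero_of_im_pos ha
  have hac : conj a ≠ 0 := (map_ne_zero _).2 ha0
  have hzc := ne_conj_of_im ha hz
  have h1 : z - a ≠ 0 := sub_ne_zero.2 hza
  have h2 : z - conj a ≠ 0 := sub_ne_zero.2 hzc
  have h := (((hasDerivAt_id z).sub_const a).div ((hasDerivAt_id z).sub_const (conj a)) h2).mul
    ((hasDerivAt_truncLog_div p ha0 hza).sub (hasDerivAt_truncLog_div p hac hzc)).cexp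
  refine h.congr_deriv ?_
  simp only [id, Pi.sub_apply, Pi.div_apply]
  unfold blaschkeFactor blaschkeLogDeriv
  field_simp
  ring

theorem norm_blaschkeLogDeriv_le (p : ℕ) {a z : ℂ} {c : ℝ} (ha : 0 < a.im) (hc : 0 < c)
    (hza : c * ‖a‖ ≤ ‖a‖ - ‖z‖) :
    ‖blaschkeLogDeriv p a z‖ ≤ 2 * (‖z‖ / ‖a‖) ^ p / (c * ‖a‖) := by
  have ha0 : 0 < ‖a‖ := norm_pos_iff.2 (ne_zero_of_im_pos ha)
  have h1 : c * ‖a‖ ≤ ‖z - a‖ := by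
    have := norm_sub_norm_le a z
    rw [norm_sub_rev] at this
    linarith
  have h2 : c * ‖a‖ ≤ ‖z - conj a‖ := by
    have := norm_sub_norm_le (conj a) z
    rw [norm_sub_rev, Complex.norm_conj] at this
    linarith
  have h0 : 0 < c * ‖a‖ := by positivity
  unfold blaschkeLogDeriv
  refine (norm_sub_le _ _).trans ?_
  rw [norm_div, norm_div, norm_pow, norm_pow, norm_div, norm_div, Complex.norm_conj]
  calc _ ≤ (‖z‖ / ‖a‖) ^ p / (c * ‖a‖) + (‖z‖ / ‖a‖) ^ p / (c * ‖a‖) := by gcongr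
    _ = _ := by ring

/-- An antiderivative of `blaschkeLogDeriv p a` on the real axis. -/
noncomputable def blaschkePhase (p : ℕ) (a : ℂ) (x : ℝ) : ℂ :=
  2 * Complex.I * (Real.arctan ((x - a.re) / a.im) : ℝ) +
    (truncLog p (x / a) - truncLog p (x / conj a))

/-- The arctangent is a global primitive on the line of (1/(x - a) - 1/(x - conj a)) / (2i), so no
branch of the logarithm has to be followed. -/
theorem hasDerivAt_blaschkePhase (p : ℕ) {a : ℂ} (ha : 0 < a.im) (x : ℝ) :
    HasDerivAt (blaschkePhase p a) (blaschkeLogDeriv p a x) x := by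
  have ha0 := ne_zero_of_im_pos ha
  have hac : conj a ≠ 0 := (map_ne_zero _).2 ha0
  have hxa : (x : ℂ) ≠ a := by
    intro h; rw [← h] at ha; simp at ha
  have hxc := ne_conj_of_im ha (z := x) (by simp)
  have h1 : HasDerivAt (fun x : ℝ => Real.arctan ((x - a.re) / a.im))
      (1 / (1 + ((x - a.re) / a.im) ^ 2) * (1 / a.im)) x :=
    (((hasDerivAt_id x).sub_const a.re).div_const a.im).arctan
  have h2 := (hasDerivAt_truncLog_div p ha0 hxa).comp_ofReal
  have h3 := (hasDerivAt_truncLog_div p hac hxc).comp_ofReal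
  refine ((h1.ofReal_comp.const_mul (2 * Complex.I)).add (h2.sub h3)).congr_deriv ?_
  have h4 : (x : ℂ) - a ≠ 0 := sub_ne_zero.2 hxa
  have h5 : (x : ℂ) - conj a ≠ 0 := sub_ne_zero.2 hxc
  have h6 : 2 * Complex.I * ((1 / (1 + ((x - a.re) / a.im) ^ 2) * (1 / a.im) : ℝ) : ℂ) =
      1 / (x - a) - 1 / (x - conj a) := by
    have e1 : (1 / (1 + ((x - a.re) / a.im) ^ 2) * (1 / a.im) : ℝ) =
        a.im / (a.im ^ 2 + (x - a.re) ^ 2) := by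
      field_simp
    have e2 : ((x : ℂ) - a) * (x - conj a) = ((a.im ^ 2 + (x - a.re) ^ 2 : ℝ) : ℂ) := by
      have e : (x : ℂ) - conj a = conj ((x : ℂ) - a) := by simp
      rw [e, Complex.mul_conj, Complex.normSq_apply]
      congr 1
      simp
      ring
    have e3 : a - conj a = 2 * Complex.I * (a.im : ℂ) := by
      apply Complex.ext
      · simp
      · simp; ring
    rw [e1, div_sub_div _ _ h4 h5, e2]
    push_cast
    rw [← mul_div_assoc, ← e3]
    ring
  rw [h6]
  unfold blaschkeLogDeriv
  ring

/-- The arctangent part varies by at most 2π however close a is to the axis; this settles near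
zeros. For far zeros the derivative is integrated over a length of at most 2r. -/
theorem norm_blaschkePhase_sub_le (p : ℕ) {a : ℂ} (ha : 0 < a.im) {r x y : ℝ} (hr : 0 < r)
    (hx : |x| ≤ r) (hy : |y| ≤ r) :
    ‖blaschkePhase p a x - blaschkePhase p a y‖ ≤ 8 * genusWeight p (r / ‖a‖) := by
  have ha0 : 0 < ‖a‖ := norm_pos_iff.2 (ne_zero_of_im_pos ha)
  unfold genusWeight
  split_ifs with h
  · have hT : ∀ t : ℝ, |t| ≤ r → ‖truncLog p (t / a) - truncLog p (t / conj a)‖ ≤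
        2 * ∑ j ∈ Finset.range p, (r / ‖a‖) ^ (j + 1) := by
      intro t ht
      refine (norm_truncLog_sub_truncLog_le p a t).trans ?_
      rw [Complex.norm_real, Real.norm_eq_abs]
      gcongr
    have h1 := hT x hx
    have h2 := hT y hy
    have h3 : ‖2 * Complex.I * ((Real.arctan ((x - a.re) / a.im) -
        Real.arctan ((y - a.re) / a.im) : ℝ) : ℂ)‖ ≤ 2 * Real.pi := by
      rw [norm_mul, norm_mul, Complex.norm_I, Complex.norm_real, Real.norm_eq_abs]
      have := Real.arctan_lt_pi_div_two ((x - a.re) / a.im)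
      have := Real.arctan_lt_pi_div_two ((y - a.re) / a.im)
      have := Real.neg_pi_div_two_lt_arctan ((x - a.re) / a.im)
      have := Real.neg_pi_div_two_lt_arctan ((y - a.re) / a.im)
      have h : |Real.arctan ((x - a.re) / a.im) - Real.arctan ((y - a.re) / a.im)| ≤ Real.pi := by
        rw [abs_le]; constructor <;> linarith
      norm_num
      linarith
    have h4 : blaschkePhase p a x - blaschkePhase p a y =
        2 * Complex.I * ((Real.arctan ((x - a.re) / a.im) -
          Real.arctan ((y - a.re) / a.im) : ℝ) : ℂ) +
        ((truncLog p (x / a) - truncLog p (x / conj a)) -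
        (truncLog p (y / a) - truncLog p (y / conj a))) := by
      unfold blaschkePhase
      push_cast
      ring
    have h5 : 0 ≤ ∑ j ∈ Finset.range p, (r / ‖a‖) ^ (j + 1) := by positivity
    rw [h4]
    refine (norm_add_le _ _).trans ((add_le_add h3 (norm_sub_le _ _)).trans ?_)
    linarith [Real.pi_lt_four]
  · have hfar : r ≤ ‖a‖ / 2 := by
      rw [not_lt, div_le_iff₀ ha0] at h; linarith
    have hderiv : ∀ t ∈ Set.Icc (-r) r, HasDerivWithinAt (blaschkePhase p a)
        (blaschkeLogDeriv p a t) (Set.Icc (-r) r) t :=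
      fun t _ => (hasDerivAt_blaschkePhase p ha t).hasDerivWithinAt
    have hbound : ∀ t ∈ Set.Icc (-r) r,
        ‖blaschkeLogDeriv p a t‖ ≤ 2 * (r / ‖a‖) ^ p / (1 / 2 * ‖a‖) := by
      intro t ht
      have ht' : |t| ≤ r := abs_le.2 ht
      refine (norm_blaschkeLogDeriv_le p ha (by norm_num : (0 : ℝ) < 1 / 2) ?_).trans ?_
      · rw [Complex.norm_real, Real.norm_eq_abs]; linarith
      · rw [Complex.norm_real, Real.norm_eq_abs]; gcongr
    have := (convex_Icc (-r) r).norm_image_sub_le_of_norm_hasDerivWithin_le hderiv hbound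
      (abs_le.1 hy) (abs_le.1 hx)
    refine this.trans ?_
    have h1 : ‖x - y‖ ≤ 2 * r := by
      rw [Real.norm_eq_abs]
      linarith [abs_sub x y]
    calc _ ≤ 2 * (r / ‖a‖) ^ p / (1 / 2 * ‖a‖) * (2 * r) := by gcongr
      _ = 8 * (r / ‖a‖) ^ (p + 1) := by rw [pow_succ]; field_simp; ring

/-! ### Logarithm of the quotient by a finite Blaschke product -/

/-- A nonvanishing analytic function near a compact convex set has an analytic logarithm. -/
theorem exists_analyticOnNhd_log {g : ℂ → ℂ} {S : Set ℂ} (hS : IsCompact S) (hSc : Convex ℝ S)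
    (hSne : S.Nonempty) (hg : AnalyticOnNhd ℂ g S) (hg0 : ∀ z ∈ S, g z ≠ 0) :
    ∃ H : ℂ → ℂ, AnalyticOnNhd ℂ H S ∧ ∀ z ∈ S, ∀ᶠ w in nhds z, Complex.exp (H w) = g w := by
  have hU : IsOpen {z | AnalyticAt ℂ g z ∧ g z ≠ 0} := by
    rw [isOpen_iff_mem_nhds]
    rintro z ⟨h1, h2⟩
    exact h1.eventually_analyticAt.and (h1.continuousAt.eventually_ne h2)
  obtain ⟨δ, hδ, hsub⟩ := hS.exists_thickening_subset_open hU fun z hz => ⟨hg z hz, hg0 z hz⟩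
  have hST : S ⊆ Metric.thickening δ S := Metric.self_subset_thickening hδ S
  have hsc : IsSimplyConnected (Metric.thickening δ S) := by
    have := (hSc.thickening δ).contractibleSpace (hSne.mono hST)
    exact (inferInstance : SimplyConnectedSpace (Metric.thickening δ S))
  obtain ⟨H, hHc, hH⟩ := Complex.exists_continuousOn_eqOn_exp_comp hsc Metric.isOpen_thickening
    (g := g) (fun z hz => (hsub hz).1.continuousAt.continuousWithinAt)
    (by rintro ⟨z, hz, h0⟩; exact (hsub hz).2 h0)
  have hev : ∀ z ∈ S, ∀ᶠ w in nhds z, w ∈ Metric.thickening δ S := fun z hz =>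
    Metric.isOpen_thickening.mem_nhds (hST hz)
  refine ⟨H, fun z hz => ?_, fun z hz => (hev z hz).mono fun w hw => hH hw⟩
  have hcont : ContinuousAt H z := hHc.continuousAt (hev z hz)
  -- A continuous logarithm is analytic: near z the imaginary part of H w - H z stays in (-π, π), so
  -- H differs from a principal logarithm by a constant.
  have hloc : (fun w => H z + Complex.log (g w / g z)) =ᶠ[nhds z] H := by
    have h1 : ∀ᶠ w in nhds z, (H w - H z).im ∈ Set.Ioo (-Real.pi) Real.pi := by
      have : ContinuousAt (fun w => (H w - H z).im) z := by fun_prop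
      refine this.eventually_mem (Ioo_mem_nhds ?_ ?_) <;> simp [Real.pi_pos]
    filter_upwards [h1, hev z hz] with w hw hwS
    have e1 : Complex.exp (H w) = g w := hH hwS
    have e2 : Complex.exp (H z) = g z := hH (hST hz)
    rw [← e1, ← e2, ← Complex.exp_sub, Complex.log_exp hw.1 hw.2.le]
    ring
  refine AnalyticAt.congr ?_ hloc
  refine analyticAt_const.add (((hg z hz).div analyticAt_const (hg0 z hz)).clog ?_)
  simp [hg0 z hz]

/-- Division of an analytic function by the polynomial of its zeros. -/
theorem exists_eq_prod_pow_mul {f : ℂ → ℂ} {D : Set ℂ} (Z : Finset ℂ)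
    (hf : AnalyticOnNhd ℂ f D) (hord : ∀ z ∈ D, analyticOrderAt f z ≠ ⊤) (hZD : ∀ a ∈ Z, a ∈ D)
    (hZ : ∀ z ∈ D, f z = 0 → z ∈ Z) :
    ∃ g : ℂ → ℂ, AnalyticOnNhd ℂ g D ∧ (∀ z ∈ D, g z ≠ 0) ∧ ∀ z ∈ D,
      ∀ᶠ w in nhds z, f w = (∏ a ∈ Z, (w - a) ^ analyticOrderNatAt f a) * g w := by
  classical
  have hloc : ∀ a : ℂ, ∃ h : ℂ → ℂ, a ∈ Z → AnalyticAt ℂ h a ∧ h a ≠ 0 ∧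
      ∀ᶠ w in nhds a, f w = (w - a) ^ analyticOrderNatAt f a * h w := by
    intro a
    by_cases ha : a ∈ Z
    · obtain ⟨h, h1, h2, h3⟩ := (hf a (hZD a ha)).analyticOrderAt_ne_top.1 (hord a (hZD a ha))
      exact ⟨h, fun _ => ⟨h1, h2, h3⟩⟩
    · exact ⟨0, fun h => absurd h ha⟩
  choose h hh using hloc
  set P : ℂ → ℂ := fun w => ∏ b ∈ Z, (w - b) ^ analyticOrderNatAt f b with hP
  set Q : ℂ → ℂ → ℂ := fun a w => ∏ b ∈ Z.erase a, (w - b) ^ analyticOrderNatAt f b with hQ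
  have hPan : ∀ z, AnalyticAt ℂ P z := fun z => by
    refine Finset.analyticAt_fun_prod _ fun b _ => ?_
    fun_prop
  have hQan : ∀ a z, AnalyticAt ℂ (Q a) z := fun a z => by
    refine Finset.analyticAt_fun_prod _ fun b _ => ?_
    fun_prop
  have hQ0 : ∀ a, Q a a ≠ 0 := fun a => Finset.prod_ne_zero_iff.2 fun b hb =>
    pow_ne_zero _ (sub_ne_zero.2 (Finset.ne_of_mem_erase hb).symm)
  have hPQ : ∀ a ∈ Z, ∀ w, P w = (w - a) ^ analyticOrderNatAt f a * Q a w := fun a ha w =>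
    (Finset.mul_prod_erase Z (fun b => (w - b) ^ analyticOrderNatAt f b) ha).symm
  have hP0 : ∀ z, z ∉ Z → P z ≠ 0 := fun z hz => Finset.prod_ne_zero_iff.2 fun b hb =>
    pow_ne_zero _ (sub_ne_zero.2 fun h => hz (h ▸ hb))
  have hnot : ∀ z, z ∉ Z → ∀ᶠ w in nhds z, w ∉ Z := fun z hz =>
    (Z.finite_toSet.isClosed.isOpen_compl).mem_nhds hz
  have hnot' : ∀ z, ∀ᶠ w in nhds z, w ∈ Z → w = z := fun z => by
    have := ((Z.erase z).finite_toSet.isClosed.isOpen_compl).mem_nhds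
      (show z ∈ ((Z.erase z : Finset ℂ) : Set ℂ)ᶜ by simp)
    filter_upwards [this] with w hw hwZ
    by_contra hne
    exact hw (by simp [hwZ, hne])
  -- At a zero the quotient f / P would be 0 / 0; the value is supplied by the local factorization.
  set g : ℂ → ℂ := fun w => if w ∈ Z then h w w / Q w w else f w / P w with hg
  have hgZ : ∀ a ∈ Z, (fun w => h a w / Q a w) =ᶠ[nhds a] g := by
    intro a ha
    filter_upwards [hnot' a, (hh a ha).2.2, (hQan a a).continuousAt.eventually_ne (hQ0 a)]
      with w h1 h2 h3
    by_cases hw : w ∈ Z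
    · rw [h1 hw]; simp [hg, ha]
    · have hwa : w - a ≠ 0 := sub_ne_zero.2 fun e => hw (e ▸ ha)
      simp only [hg, if_neg hw]
      rw [h2, hPQ a ha, mul_div_mul_left _ _ (pow_ne_zero _ hwa)]
  have hgn : ∀ z, z ∉ Z → (fun w => f w / P w) =ᶠ[nhds z] g := by
    intro z hz
    filter_upwards [hnot z hz] with w hw
    simp only [hg, if_neg hw]
  refine ⟨g, fun z hz => ?_, fun z hz => ?_, fun z hz => ?_⟩
  · by_cases hzZ : z ∈ Z
    · exact ((hh z hzZ).1.div (hQan z z) (hQ0 z)).congr (hgZ z hzZ)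
    · exact ((hf z hz).div (hPan z) (hP0 z hzZ)).congr (hgn z hzZ)
  · by_cases hzZ : z ∈ Z
    · simp only [hg, if_pos hzZ]
      exact div_ne_zero (hh z hzZ).2.1 (hQ0 z)
    · simp only [hg, if_neg hzZ]
      exact div_ne_zero (fun h0 => hzZ (hZ z hz h0)) (hP0 z hzZ)
  · by_cases hzZ : z ∈ Z
    · filter_upwards [hgZ z hzZ, (hh z hzZ).2.2,
        (hQan z z).continuousAt.eventually_ne (hQ0 z)] with w h1 h2 h3
      change f w = P w * g w
      rw [← h1, h2, hPQ z hzZ, mul_assoc, mul_div_cancel₀ _ h3]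
    · filter_upwards [hgn z hzZ, (hPan z).continuousAt.eventually_ne (hP0 z hzZ)] with w h1 h2
      change f w = P w * g w
      rw [← h1, mul_div_cancel₀ _ h2]

/-- A finite product of Blaschke factors of genus `p` with multiplicities `m`. -/
noncomputable def blaschkeProd (p : ℕ) (Z : Finset ℂ) (m : ℂ → ℕ) (z : ℂ) : ℂ :=
  ∏ a ∈ Z, blaschkeFactor p a z ^ m a

theorem norm_blaschkeProd_le (p : ℕ) {Z : Finset ℂ} (m : ℂ → ℕ) (hZ : ∀ a ∈ Z, 0 < a.im) {z : ℂ}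
    (hz : 0 ≤ z.im) :
    ‖blaschkeProd p Z m z‖ ≤ Real.exp (4 * ∑ a ∈ Z, m a * genusWeight p (‖z‖ / ‖a‖)) := by
  unfold blaschkeProd
  rw [norm_prod, Finset.mul_sum, Real.exp_sum]
  refine Finset.prod_le_prod (fun a _ => norm_nonneg _) fun a ha => ?_
  rw [norm_pow, mul_left_comm, Real.exp_nat_mul]
  gcongr
  exact norm_blaschkeFactor_le p (hZ a ha) hz

/-- Every zero is near here, since |a| ≤ |z|. Each ratio |z - a| / |z - conj a| is at least δ /
(2|z|), hence at least exp(-κ) because 2|z| ≤ δκ ≤ δ exp κ. -/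
theorem le_norm_blaschkeProd (p : ℕ) {Z : Finset ℂ} (m : ℂ → ℕ) (hZ : ∀ a ∈ Z, 0 < a.im) {z : ℂ}
    {κ δ : ℝ} (hz : 0 ≤ z.im) (hδ : 0 ≤ δ) (hκ : 2 * ‖z‖ ≤ δ * κ) (hz0 : 0 < ‖z‖)
    (hZz : ∀ a ∈ Z, ‖a‖ ≤ ‖z‖ - δ) :
    Real.exp (-(κ * ∑ a ∈ Z, (m a : ℝ) + 4 * ∑ a ∈ Z, m a * genusWeight p (‖z‖ / ‖a‖))) ≤
      ‖blaschkeProd p Z m z‖ := by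
  unfold blaschkeProd
  rw [norm_prod, Finset.mul_sum, Finset.mul_sum, ← Finset.sum_add_distrib,
    ← Finset.sum_neg_distrib, Real.exp_sum]
  refine Finset.prod_le_prod (fun a _ => (Real.exp_pos _).le) fun a ha => ?_
  have ha0 : 0 < ‖a‖ := norm_pos_iff.2 (ne_zero_of_im_pos (hZ a ha))
  have h1 := hZz a ha
  rw [norm_pow, show -(κ * (m a : ℝ) + 4 * (m a * genusWeight p (‖z‖ / ‖a‖))) =
    m a * (-κ + -(4 * genusWeight p (‖z‖ / ‖a‖))) by ring, Real.exp_nat_mul]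
  refine pow_le_pow_left₀ (Real.exp_pos _).le ?_ _
  rw [Real.exp_add]
  refine le_trans ?_ (le_norm_blaschkeFactor p (hZ a ha) hz hδ ?_ ?_)
  · gcongr
    have h2 : κ * δ ≤ Real.exp κ * δ := by
      gcongr
      linarith [Real.add_one_le_exp κ]
    rw [Real.exp_neg, le_div_iff₀ (by positivity), inv_mul_le_iff₀ (Real.exp_pos _)]
    linarith
  · have := norm_sub_norm_le z a
    linarith
  · rw [lt_div_iff₀ ha0]; linarith

theorem norm_blaschkeProd_ofReal (p : ℕ) {Z : Finset ℂ} (m : ℂ → ℕ) (hZ : ∀ a ∈ Z, 0 < a.im)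
    (x : ℝ) : ‖blaschkeProd p Z m x‖ = 1 := by
  unfold blaschkeProd
  rw [norm_prod]
  refine Finset.prod_eq_one fun a ha => ?_
  rw [norm_pow, norm_blaschkeFactor_ofReal p (hZ a ha), one_pow]

theorem blaschkeFactor_ne_zero (p : ℕ) {a z : ℂ} (ha : 0 < a.im) (hz : 0 ≤ z.im) (hza : z ≠ a) :
    blaschkeFactor p a z ≠ 0 :=
  mul_ne_zero (div_ne_zero (sub_ne_zero.2 hza) (sub_ne_zero.2 (ne_conj_of_im ha hz)))
    (Complex.exp_ne_zero _)

theorem blaschkeProd_ne_zero (p : ℕ) {Z : Finset ℂ} (m : ℂ → ℕ) (hZ : ∀ a ∈ Z, 0 < a.im) {z : ℂ}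
    (hz : 0 ≤ z.im) (hzZ : z ∉ Z) : blaschkeProd p Z m z ≠ 0 :=
  Finset.prod_ne_zero_iff.2 fun a ha =>
    pow_ne_zero _ (blaschkeFactor_ne_zero p (hZ a ha) hz fun h => hzZ (h ▸ ha))

theorem hasDerivAt_blaschkeProd (p : ℕ) {Z : Finset ℂ} (m : ℂ → ℕ) (hZ : ∀ a ∈ Z, 0 < a.im) {z : ℂ}
    (hz : 0 ≤ z.im) (hzZ : z ∉ Z) :
    HasDerivAt (blaschkeProd p Z m)
      (blaschkeProd p Z m z * ∑ a ∈ Z, m a * blaschkeLogDeriv p a z) z := by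
  have hd : ∀ a ∈ Z, HasDerivAt (blaschkeFactor p a)
      (blaschkeFactor p a z * blaschkeLogDeriv p a z) z := fun a ha =>
    hasDerivAt_blaschkeFactor p (hZ a ha) hz fun h => hzZ (h ▸ ha)
  have hdp : ∀ a ∈ Z, DifferentiableAt ℂ (fun z => blaschkeFactor p a z ^ m a) z := fun a ha =>
    (hd a ha).differentiableAt.fun_pow _
  have h0 := blaschkeProd_ne_zero p m hZ hz hzZ
  have hdiff : DifferentiableAt ℂ (blaschkeProd p Z m) z := by
    unfold blaschkeProd
    exact DifferentiableAt.fun_finsetProd hdp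
  refine hdiff.hasDerivAt.congr_deriv ?_
  have hl : logDeriv (blaschkeProd p Z m) z = ∑ a ∈ Z, m a * blaschkeLogDeriv p a z := by
    unfold blaschkeProd
    rw [logDeriv_prod (f := fun a z => blaschkeFactor p a z ^ m a)
      (fun a ha => pow_ne_zero _ (blaschkeFactor_ne_zero p (hZ a ha) hz fun h => hzZ (h ▸ ha))) hdp]
    refine Finset.sum_congr rfl fun a ha => ?_
    have hb := blaschkeFactor_ne_zero p (hZ a ha) hz fun h => hzZ (h ▸ ha)
    rw [logDeriv_fun_pow (hd a ha).differentiableAt, logDeriv_apply, (hd a ha).deriv,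
      mul_div_cancel_left₀ _ hb]
  rw [← hl, logDeriv_apply, mul_div_cancel₀ _ h0]

/-- Division of an analytic function in the closed upper half plane by a Blaschke product. -/
theorem exists_eq_blaschkeProd_mul (p : ℕ) {f : ℂ → ℂ} {D : Set ℂ} (Z : Finset ℂ)
    (hD : ∀ z ∈ D, 0 ≤ z.im) (hf : AnalyticOnNhd ℂ f D)
    (hord : ∀ z ∈ D, analyticOrderAt f z ≠ ⊤) (hZD : ∀ a ∈ Z, a ∈ D) (hZim : ∀ a ∈ Z, 0 < a.im)
    (hZ : ∀ z ∈ D, f z = 0 → z ∈ Z) :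
    ∃ G : ℂ → ℂ, AnalyticOnNhd ℂ G D ∧ (∀ z ∈ D, G z ≠ 0) ∧ ∀ z ∈ D,
      ∀ᶠ w in nhds z, f w = blaschkeProd p Z (analyticOrderNatAt f) w * G w := by
  obtain ⟨g, hg, hg0, hfg⟩ := exists_eq_prod_pow_mul Z hf hord hZD hZ
  -- The factor q is the zero-free ratio of z - a to the Blaschke factor, so the division by a
  -- polynomial carries over.
  set q : ℂ → ℂ → ℂ := fun a z =>
    (z - conj a) * Complex.exp (-(truncLog p (z / a) - truncLog p (z / conj a))) with hq
  have hqan : ∀ a z, AnalyticAt ℂ (q a) z := by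
    intro a z
    rw [hq]
    unfold truncLog
    simp only [div_eq_mul_inv]
    fun_prop
  have hbq : ∀ a w, w ≠ conj a → blaschkeFactor p a w * q a w = w - a := by
    intro a w hw
    have : w - conj a ≠ 0 := sub_ne_zero.2 hw
    simp only [hq, blaschkeFactor, Complex.exp_neg]
    have := Complex.exp_ne_zero (truncLog p (w / a) - truncLog p (w / conj a))
    field_simp
  refine ⟨fun z => (∏ a ∈ Z, q a z ^ analyticOrderNatAt f a) * g z, fun z hz => ?_,
    fun z hz => ?_, fun z hz => ?_⟩
  · refine AnalyticAt.mul (Finset.analyticAt_fun_prod _ fun a _ => (hqan a z).pow _) (hg z hz)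
  · refine mul_ne_zero (Finset.prod_ne_zero_iff.2 fun a ha => pow_ne_zero _ ?_) (hg0 z hz)
    exact mul_ne_zero (sub_ne_zero.2 (ne_conj_of_im (hZim a ha) (hD z hz))) (Complex.exp_ne_zero _)
  · have hne : ∀ᶠ w in nhds z, ∀ a ∈ Z, w ≠ conj a := by
      rw [Filter.eventually_all_finset]
      intro a ha
      exact isOpen_ne.mem_nhds (ne_conj_of_im (hZim a ha) (hD z hz))
    filter_upwards [hfg z hz, hne] with w h1 h2
    rw [h1, blaschkeProd, ← mul_assoc, ← Finset.prod_mul_distrib]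
    congr 1
    refine Finset.prod_congr rfl fun a ha => ?_
    rw [← mul_pow, hbq a w (h2 a ha)]

theorem exp_im_nonneg {ζ : ℂ} (h0 : 0 ≤ ζ.im) (h1 : ζ.im ≤ Real.pi) : 0 ≤ (Complex.exp ζ).im := by
  rw [Complex.exp_im]
  exact mul_nonneg (Real.exp_pos _).le (Real.sin_nonneg_of_nonneg_of_le_pi h0 h1)

/-- In logarithmic coordinates, the quotient of `f` by the Blaschke product of its zeros in a half
annulus is the exponential of an analytic function. -/
theorem exists_log_div_blaschkeProd (p : ℕ) {f : ℂ → ℂ} {α β : ℝ} (hαβ : α ≤ β) (Z : Finset ℂ)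
    (hf : ∀ z : ℂ, 0 ≤ z.im → Real.exp α ≤ ‖z‖ → AnalyticAt ℂ f z)
    (hord : ∀ z : ℂ, 0 ≤ z.im → Real.exp α ≤ ‖z‖ → analyticOrderAt f z ≠ ⊤)
    (hZ : ∀ z : ℂ, z ∈ Z ↔ 0 ≤ z.im ∧ Real.exp α ≤ ‖z‖ ∧ ‖z‖ ≤ Real.exp β ∧ f z = 0)
    (hZim : ∀ a ∈ Z, 0 < a.im) :
    ∃ H : ℂ → ℂ, AnalyticOnNhd ℂ H (Set.Icc α β ×ℂ Set.Icc 0 Real.pi) ∧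
      (∀ ζ ∈ Set.Icc α β ×ℂ Set.Icc 0 Real.pi, f (Complex.exp ζ) =
        blaschkeProd p Z (analyticOrderNatAt f) (Complex.exp ζ) * Complex.exp (H ζ)) ∧
      (∀ ζ ∈ Set.Icc α β ×ℂ Set.Icc 0 Real.pi, f (Complex.exp ζ) ≠ 0 →
        HasDerivAt H ((deriv f (Complex.exp ζ) / f (Complex.exp ζ) -
          ∑ a ∈ Z, analyticOrderNatAt f a * blaschkeLogDeriv p a (Complex.exp ζ)) *
            Complex.exp ζ) ζ) ∧
      ‖H α‖ ≤ |Real.log ‖f (Real.exp α : ℝ)‖| + Real.pi := by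
  set D : Set ℂ := {z | 0 ≤ z.im ∧ Real.exp α ≤ ‖z‖ ∧ ‖z‖ ≤ Real.exp β} with hD
  set m := analyticOrderNatAt f with hm
  obtain ⟨G, hG, hG0, hfG⟩ := exists_eq_blaschkeProd_mul p (D := D) Z (fun z hz => hz.1)
    (fun z hz => hf z hz.1 hz.2.1) (fun z hz => hord z hz.1 hz.2.1)
    (fun a ha => by obtain ⟨h1, h2, h3, -⟩ := (hZ a).1 ha; exact ⟨h1, h2, h3⟩) hZim
    (fun z hz h0 => (hZ z).2 ⟨hz.1, hz.2.1, hz.2.2, h0⟩)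
  set S : Set ℂ := Set.Icc α β ×ℂ Set.Icc 0 Real.pi with hS
  have hmem : ∀ ζ ∈ S, Complex.exp ζ ∈ D := by
    intro ζ hζ
    refine ⟨exp_im_nonneg hζ.2.1 hζ.2.2, ?_, ?_⟩ <;> rw [Complex.norm_exp, Real.exp_le_exp]
    · exact hζ.1.1
    · exact hζ.1.2
  have hαS : (α : ℂ) ∈ S := ⟨⟨by simp, by simpa using hαβ⟩, by simp, by simpa using Real.pi_pos.le⟩
  obtain ⟨H₀, hH₀, hexp⟩ := exists_analyticOnNhd_log (g := fun ζ => G (Complex.exp ζ))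
    (S := S) (isCompact_Icc.reProdIm isCompact_Icc)
    (((convex_Icc α β).linear_preimage Complex.reLm).inter
      ((convex_Icc 0 Real.pi).linear_preimage Complex.imLm)) ⟨α, hαS⟩
    (fun ζ hζ => (hG _ (hmem ζ hζ)).fun_comp analyticAt_cexp)
    (fun ζ hζ => hG0 _ (hmem ζ hζ))
  -- A multiple of 2πi that makes the value at α a principal logarithm: its imaginary part is at
  -- most π, and its real part is log |f| because |B| = 1 on the axis. The initial value is thus
  -- bounded independently of Z.
  set c : ℂ := Complex.log (Complex.exp (H₀ α)) - H₀ α with hc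
  have hc1 : Complex.exp c = 1 := by
    rw [hc, Complex.exp_sub, Complex.exp_log (Complex.exp_ne_zero _),
      div_self (Complex.exp_ne_zero _)]
  have hexp' : ∀ ζ ∈ S, ∀ᶠ w in nhds ζ, Complex.exp (H₀ w + c) = G (Complex.exp w) := by
    intro ζ hζ
    filter_upwards [hexp ζ hζ] with w hw
    rw [Complex.exp_add, hc1, mul_one, hw]
  have heq : ∀ ζ ∈ S, f (Complex.exp ζ) =
      blaschkeProd p Z m (Complex.exp ζ) * Complex.exp (H₀ ζ + c) := by
    intro ζ hζ
    rw [(hfG _ (hmem ζ hζ)).self_of_nhds, (hexp' ζ hζ).self_of_nhds]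
  refine ⟨fun ζ => H₀ ζ + c, fun ζ hζ => (hH₀ ζ hζ).add analyticAt_const, heq, ?_, ?_⟩
  · intro ζ hζ hfζ
    have hzD := hmem ζ hζ
    have hzZ : Complex.exp ζ ∉ Z := fun h => hfζ ((hZ _).1 h).2.2.2
    have hHan : AnalyticAt ℂ (fun ζ => H₀ ζ + c) ζ := (hH₀ ζ hζ).add analyticAt_const
    have hHd := hHan.differentiableAt.hasDerivAt
    have hGd := (hG _ hzD).differentiableAt.hasDerivAt
    have hGe := hGd.comp ζ (Complex.hasDerivAt_exp ζ)
    have h1 := (hHd.cexp.congr_of_eventuallyEq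
      (Filter.EventuallyEq.symm (hexp' ζ hζ))).unique hGe
    have hB := hasDerivAt_blaschkeProd p m hZim hzD.1 hzZ
    have h2 := ((hB.mul hGd).congr_of_eventuallyEq (hfG _ hzD)).deriv
    have h3 : f (Complex.exp ζ) = blaschkeProd p Z m (Complex.exp ζ) * G (Complex.exp ζ) :=
      (hfG _ hzD).self_of_nhds
    have h4 := (hexp' ζ hζ).self_of_nhds
    have hB0 := blaschkeProd_ne_zero p m hZim hzD.1 hzZ
    have hGz := hG0 _ hzD
    refine hHd.congr_deriv ?_
    rw [h4] at h1
    rw [h2, h3]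
    have h5 : deriv (fun ζ => H₀ ζ + c) ζ =
        deriv G (Complex.exp ζ) * Complex.exp ζ / G (Complex.exp ζ) := by
      rw [← h1, mul_div_cancel_left₀ _ hGz]
    rw [h5]
    field_simp
    ring
  · have h1 : H₀ α + c = Complex.log (Complex.exp (H₀ α)) := by rw [hc]; ring
    have h2 : ‖f (Real.exp α : ℝ)‖ = ‖Complex.exp (H₀ α)‖ := by
      have := heq α hαS
      rw [Complex.exp_add, hc1, mul_one, ← Complex.ofReal_exp] at this
      rw [this, norm_mul, norm_blaschkeProd_ofReal p m hZim, one_mul]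
    change ‖H₀ α + c‖ ≤ _
    rw [h1, h2]
    refine (Complex.norm_le_abs_re_add_abs_im _).trans ?_
    rw [Complex.log_re, Complex.log_im]
    gcongr
    exact Complex.abs_arg_le_pi _

/-! ### Bounds on three sides of the rectangle -/

theorem norm_blaschkeLogDeriv_le_genusWeight (p : ℕ) {a z : ℂ} {c : ℝ} (ha : 0 < a.im)
    (hc : 0 < c) (hz : 1 ≤ ‖z‖) (hza : c * ‖a‖ ≤ ‖a‖ - ‖z‖) :
    ‖blaschkeLogDeriv p a z‖ ≤ 2 / c * genusWeight p (‖z‖ / ‖a‖) := by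
  have ha0 : 0 < ‖a‖ := norm_pos_iff.2 (ne_zero_of_im_pos ha)
  have h2 : (‖z‖ / ‖a‖) ^ (p + 1) ≤ genusWeight p (‖z‖ / ‖a‖) := by
    unfold genusWeight
    split_ifs with h
    · have h3 : ‖z‖ / ‖a‖ ≤ 1 := by
        rw [div_le_one ha0]
        have : 0 < c * ‖a‖ := by positivity
        linarith
      have h4 : (‖z‖ / ‖a‖) ^ (p + 1) ≤ 1 := pow_le_one₀ (by positivity) h3
      have h5 : 0 ≤ ∑ j ∈ Finset.range p, (‖z‖ / ‖a‖) ^ (j + 1) := by positivity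
      linarith
    · exact le_rfl
  have h3 : 2 * (‖z‖ / ‖a‖) ^ p / (c * ‖a‖) ≤ 2 / c * (‖z‖ / ‖a‖) ^ (p + 1) := by
    rw [pow_succ, show 2 / c * ((‖z‖ / ‖a‖) ^ p * (‖z‖ / ‖a‖)) =
      2 * (‖z‖ / ‖a‖) ^ p / (c * ‖a‖) * ‖z‖ by field_simp]
    exact le_mul_of_one_le_right (by positivity) hz
  exact (norm_blaschkeLogDeriv_le p ha hc hza).trans (h3.trans (by gcongr))

theorem norm_sum_blaschkeLogDeriv_le (p : ℕ) {Z : Finset ℂ} (m : ℂ → ℕ) {z : ℂ} {c : ℝ}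
    (hZim : ∀ a ∈ Z, 0 < a.im) (hc : 0 < c) (hz : 1 ≤ ‖z‖)
    (hZc : ∀ a ∈ Z, c * ‖a‖ ≤ ‖a‖ - ‖z‖) :
    ‖∑ a ∈ Z, m a * blaschkeLogDeriv p a z‖ ≤
      2 / c * ∑ a ∈ Z, m a * genusWeight p (‖z‖ / ‖a‖) := by
  refine (norm_sum_le _ _).trans ?_
  rw [Finset.mul_sum]
  refine Finset.sum_le_sum fun a ha => ?_
  rw [norm_mul, Complex.norm_natCast, mul_left_comm]
  gcongr
  exact norm_blaschkeLogDeriv_le_genusWeight p (hZim a ha) hc hz (hZc a ha)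

/-- Change of an analytic function along the left side of a rectangle. -/
theorem norm_le_on_left_side {H : ℂ → ℂ} {α N₀ M : ℝ} (hM : 0 ≤ M) (hHα : ‖H α‖ ≤ N₀)
    (hH : ∀ θ ∈ Set.Icc 0 Real.pi, ∃ v : ℂ, ‖v‖ ≤ M ∧ HasDerivAt H v (α + θ * Complex.I))
    {θ : ℝ} (hθ : θ ∈ Set.Icc 0 Real.pi) : ‖H (α + θ * Complex.I)‖ ≤ N₀ + Real.pi * M := by
  have hγd : ∀ t : ℝ, HasDerivAt (fun t : ℝ => (α : ℂ) + t * Complex.I) Complex.I t := by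
    intro t
    have := ((hasDerivAt_id t).ofReal_comp.mul_const Complex.I).const_add (α : ℂ)
    exact this.congr_deriv (by simp)
  choose! v hv1 hv2 using hH
  have := (convex_Icc 0 Real.pi).norm_image_sub_le_of_norm_hasDerivWithin_le
    (f := fun t : ℝ => H (α + t * Complex.I)) (f' := fun t => v t * Complex.I) (C := M)
    (fun t ht => ((hv2 t ht).comp t (hγd t)).hasDerivWithinAt)
    (fun t ht => by rw [norm_mul, Complex.norm_I, mul_one]; exact hv1 t ht)
    (Set.left_mem_Icc.2 Real.pi_pos.le) hθ
  simp only [Complex.ofReal_zero, zero_mul, add_zero, sub_zero, Real.norm_eq_abs,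
    abs_of_nonneg hθ.1] at this
  have h1 : M * θ ≤ Real.pi * M := by
    rw [mul_comm Real.pi]
    exact mul_le_mul_of_nonneg_left hθ.2 hM
  have h2 := norm_sub_norm_le (H (α + θ * Complex.I)) (H α)
  linarith

/-- The left side is the integral of C₀ exp(ρu) over [α, t]. For ρ < 0 it stays below C₀/|ρ|, which
the exponent σ ≥ 0 accommodates. -/
theorem div_mul_exp_sub_exp_le {ρ σ α t C₀ : ℝ} (hα : 0 ≤ α) (ht : α ≤ t) (hC₀ : 0 ≤ C₀)
    (hρ : ρ ≠ 0) (hσ0 : 0 ≤ σ) (hσρ : ρ ≤ σ) :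
    C₀ / ρ * (Real.exp (ρ * t) - Real.exp (ρ * α)) ≤ C₀ / |ρ| * Real.exp (σ * t) := by
  have ht0 : 0 ≤ t := hα.trans ht
  rcases lt_or_gt_of_ne hρ with h | h
  · rw [abs_of_neg h]
    have e1 : Real.exp (ρ * α) ≤ 1 :=
      Real.exp_le_one_iff.2 (mul_nonpos_of_nonpos_of_nonneg h.le hα)
    have e2 : 1 ≤ Real.exp (σ * t) := Real.one_le_exp (mul_nonneg hσ0 ht0)
    have e3 := Real.exp_pos (ρ * t)
    have e4 : C₀ / ρ = -(C₀ / -ρ) := by rw [div_neg, neg_neg]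
    have e5 : 0 ≤ C₀ / -ρ := div_nonneg hC₀ (by linarith)
    rw [e4]
    nlinarith
  · rw [abs_of_pos h]
    have e1 : Real.exp (ρ * t) ≤ Real.exp (σ * t) := by
      rw [Real.exp_le_exp]; gcongr
    have e3 := Real.exp_pos (ρ * α)
    gcongr
    linarith

/-- Change along a horizontal side of the logarithm of the quotient of `f` by a Blaschke product. -/
theorem norm_le_on_horizontal_side (p : ℕ) {f H : ℂ → ℂ} {α β ρ σ C₀ K N₁ : ℝ} {Z : Finset ℂ}
    {m : ℂ → ℕ} (hα : 0 ≤ α) (hC₀ : 0 ≤ C₀) (hρ : ρ ≠ 0) (hσ0 : 0 ≤ σ) (hσρ : ρ ≤ σ)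
    (hZim : ∀ a ∈ Z, 0 < a.im)
    (hW : ∀ r : ℝ, 1 ≤ r → ∑ a ∈ Z, m a * genusWeight p (r / ‖a‖) ≤ K * r ^ σ)
    (hreal : ∀ x : ℝ, Real.exp α ≤ |x| → f x ≠ 0 ∧ ‖deriv f x / f x‖ ≤ C₀ * |x| ^ (ρ - 1))
    (hH : ∀ ζ ∈ Set.Icc α β ×ℂ Set.Icc 0 Real.pi, f (Complex.exp ζ) ≠ 0 →
        HasDerivAt H ((deriv f (Complex.exp ζ) / f (Complex.exp ζ) -
          ∑ a ∈ Z, m a * blaschkeLogDeriv p a (Complex.exp ζ)) * Complex.exp ζ) ζ)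
    {η : ℂ} {ε : ℝ} (hε : |ε| = 1) (hη : Complex.exp η = ε) (hηre : η.re = 0)
    (hηim : η.im ∈ Set.Icc 0 Real.pi) (hHη : ‖H (α + η)‖ ≤ N₁) {t : ℝ} (ht : t ∈ Set.Icc α β) :
    ‖H (t + η)‖ ≤ N₁ + (C₀ / |ρ| + 8 * K) * Real.exp (σ * t) := by
  -- The pair (η, ε) is (0, 1) on the bottom side and (πi, -1) on the top. Adding ℓ to H cancels the
  -- Blaschke part of the derivative and leaves x f'(x)/f(x), which is integrable independently of
  -- Z.
  set ℓ : ℝ → ℂ := fun x => ∑ a ∈ Z, m a * blaschkePhase p a x with hℓ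
  have hℓd : ∀ x : ℝ, HasDerivAt ℓ (∑ a ∈ Z, m a * blaschkeLogDeriv p a x) x := fun x =>
    HasDerivAt.fun_sum fun a ha => (hasDerivAt_blaschkePhase p (hZim a ha) x).const_mul _
  have hS : ∀ u ∈ Set.Icc α β, (u : ℂ) + η ∈ Set.Icc α β ×ℂ Set.Icc 0 Real.pi := by
    intro u hu
    simp only [Complex.mem_reProdIm]
    simpa [hηre, hu.1, hu.2] using hηim
  have he : ∀ u : ℝ, Complex.exp (u + η) = ((ε * Real.exp u : ℝ) : ℂ) := by
    intro u
    rw [Complex.exp_add, hη]; push_cast; ring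
  have habs : ∀ u : ℝ, |ε * Real.exp u| = Real.exp u := by
    intro u; rw [abs_mul, hε, one_mul, abs_of_pos (Real.exp_pos u)]
  set F : ℝ → ℂ := fun u => H (u + η) + ℓ (ε * Real.exp u) -
    (H (α + η) + ℓ (ε * Real.exp α)) with hF
  have hFd : ∀ u ∈ Set.Icc α β, ∃ v : ℂ, HasDerivAt F v u ∧ ‖v‖ ≤ C₀ * Real.exp (ρ * u) := by
    intro u hu
    have hr := hreal (ε * Real.exp u) (by rw [habs]; exact Real.exp_le_exp.2 hu.1)
    have hfu : f (Complex.exp (u + η)) ≠ 0 := by rw [he]; exact hr.1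
    have d1 := (hH _ (hS u hu) hfu)
    have d2 : HasDerivAt (fun u : ℝ => (u : ℂ) + η) 1 u :=
      (hasDerivAt_id u).ofReal_comp.add_const η
    have d3 := d1.comp u d2
    have d4 : HasDerivAt (fun u : ℝ => ε * Real.exp u) (ε * Real.exp u) u :=
      (Real.hasDerivAt_exp u).const_mul ε
    have d5 := (hℓd (ε * Real.exp u)).scomp u d4
    refine ⟨_, (d3.add d5).sub_const _, ?_⟩
    have : (deriv f (Complex.exp (u + η)) / f (Complex.exp (u + η)) -
        ∑ a ∈ Z, m a * blaschkeLogDeriv p a (Complex.exp (u + η))) * Complex.exp (u + η) * 1 +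
        (ε * Real.exp u) • ∑ a ∈ Z, m a * blaschkeLogDeriv p a ((ε * Real.exp u : ℝ) : ℂ) =
        deriv f ((ε * Real.exp u : ℝ) : ℂ) / f ((ε * Real.exp u : ℝ) : ℂ) *
          ((ε * Real.exp u : ℝ) : ℂ) := by
      rw [he, Complex.real_smul]
      ring
    rw [this, norm_mul, Complex.norm_real, Real.norm_eq_abs, habs]
    refine (mul_le_mul_of_nonneg_right hr.2 (Real.exp_pos u).le).trans_eq ?_
    rw [habs, ← Real.exp_mul, mul_assoc, ← Real.exp_add]
    congr 2
    ring
  choose! v hv1 hv2 using hFd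
  have hBd : ∀ u : ℝ, HasDerivAt (fun u => C₀ / ρ * (Real.exp (ρ * u) - Real.exp (ρ * α)))
      (C₀ * Real.exp (ρ * u)) u := by
    intro u
    have := ((((hasDerivAt_id u).const_mul ρ).exp).sub_const (Real.exp (ρ * α))).const_mul (C₀ / ρ)
    refine this.congr_deriv ?_
    simp only [id]
    field_simp
  have hFt := image_norm_le_of_norm_deriv_right_le_deriv_boundary (f := F) (f' := v)
    (fun u hu => (hv1 u hu).continuousAt.continuousWithinAt)
    (fun u hu => (hv1 u (Set.Ico_subset_Icc_self hu)).hasDerivWithinAt)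
    (B := fun u => C₀ / ρ * (Real.exp (ρ * u) - Real.exp (ρ * α))) (by simp [hF]) hBd
    (fun u hu => hv2 u (Set.Ico_subset_Icc_self hu)) ht
  have ht0 : 0 ≤ t := hα.trans ht.1
  have hB := div_mul_exp_sub_exp_le hα ht.1 hC₀ hρ hσ0 hσρ
  have hphase : ‖ℓ (ε * Real.exp t) - ℓ (ε * Real.exp α)‖ ≤ 8 * K * Real.exp (σ * t) := by
    have e0 : ℓ (ε * Real.exp t) - ℓ (ε * Real.exp α) = ∑ a ∈ Z, m a *
        (blaschkePhase p a (ε * Real.exp t) - blaschkePhase p a (ε * Real.exp α)) := by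
      simp only [hℓ, ← Finset.sum_sub_distrib, mul_sub]
    rw [e0]
    refine (norm_sum_le _ _).trans ?_
    calc _ ≤ ∑ a ∈ Z, 8 * (m a * genusWeight p (Real.exp t / ‖a‖)) := by
          refine Finset.sum_le_sum fun a ha => ?_
          rw [norm_mul, Complex.norm_natCast, mul_left_comm]
          gcongr
          refine norm_blaschkePhase_sub_le p (hZim a ha) (Real.exp_pos t) (habs t).le ?_
          rw [habs]
          exact Real.exp_le_exp.2 ht.1
      _ ≤ 8 * (K * Real.exp t ^ σ) := by
          rw [← Finset.mul_sum]
          gcongr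
          exact hW _ (Real.one_le_exp ht0)
      _ = _ := by rw [← Real.exp_mul, mul_comm t σ]; ring
  have hdec : H (t + η) = F t - (ℓ (ε * Real.exp t) - ℓ (ε * Real.exp α)) + H (α + η) := by
    simp only [hF]; ring
  rw [hdec]
  refine (norm_add_le _ _).trans ?_
  have := norm_sub_le (F t) (ℓ (ε * Real.exp t) - ℓ (ε * Real.exp α))
  linarith
/-- Uniform bounds on the bottom, top and left sides for the logarithm of the quotient of `f` by a
Blaschke product. -/
theorem norm_le_on_sides (p : ℕ) {f H : ℂ → ℂ} {α β ρ σ C₀ L c K N₀ : ℝ} {Z : Finset ℂ} {m : ℂ → ℕ}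
    (hα : 0 ≤ α) (hC₀ : 0 ≤ C₀) (hc : 0 < c) (hL : 0 ≤ L) (hK : 0 ≤ K)
    (hρ : ρ ≠ 0) (hσ0 : 0 ≤ σ) (hσρ : ρ ≤ σ)
    (hZim : ∀ a ∈ Z, 0 < a.im) (hZc : ∀ a ∈ Z, c * ‖a‖ ≤ ‖a‖ - Real.exp α)
    (hW : ∀ r : ℝ, 1 ≤ r → ∑ a ∈ Z, m a * genusWeight p (r / ‖a‖) ≤ K * r ^ σ)
    (hreal : ∀ x : ℝ, Real.exp α ≤ |x| → f x ≠ 0 ∧ ‖deriv f x / f x‖ ≤ C₀ * |x| ^ (ρ - 1))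
    (harc : ∀ z : ℂ, 0 ≤ z.im → ‖z‖ = Real.exp α → f z ≠ 0 ∧ ‖deriv f z / f z‖ ≤ L)
    (hHα : ‖H α‖ ≤ N₀)
    (hH : ∀ ζ ∈ Set.Icc α β ×ℂ Set.Icc 0 Real.pi, f (Complex.exp ζ) ≠ 0 →
        HasDerivAt H ((deriv f (Complex.exp ζ) / f (Complex.exp ζ) -
          ∑ a ∈ Z, m a * blaschkeLogDeriv p a (Complex.exp ζ)) * Complex.exp ζ) ζ)
    {ζ : ℂ} (hζ : ζ ∈ Set.Icc α β ×ℂ Set.Icc 0 Real.pi)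
    (hside : ζ.im = 0 ∨ ζ.im = Real.pi ∨ ζ.re = α) :
    ‖H ζ‖ ≤ (N₀ + Real.pi * ((L + 2 / c * K * Real.exp α ^ σ) * Real.exp α) + C₀ / |ρ| + 8 * K) *
      Real.exp (σ * ζ.re) := by
  set s : ℝ := Real.exp α with hs
  have hs1 : 1 ≤ s := Real.one_le_exp hα
  have hαβ : α ≤ β := hζ.1.1.trans hζ.1.2
  -- The left side has length π, and the chain rule contributes |exp ζ| = s.
  set K₁ : ℝ := Real.pi * ((L + 2 / c * K * s ^ σ) * s) with hK₁
  have hK₁0 : 0 ≤ K₁ := by positivity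
  have hN₀ : 0 ≤ N₀ := (norm_nonneg _).trans hHα
  have hleft : ∀ θ ∈ Set.Icc 0 Real.pi, ‖H (α + θ * Complex.I)‖ ≤ N₀ + K₁ := by
    intro θ hθ
    refine norm_le_on_left_side (by positivity) hHα (fun t ht => ?_) hθ
    have htS : (α : ℂ) + t * Complex.I ∈ Set.Icc α β ×ℂ Set.Icc 0 Real.pi := by
      rw [Complex.mem_reProdIm]
      simpa [hαβ] using ht
    have hn : ‖Complex.exp (α + t * Complex.I)‖ = s := by
      rw [Complex.norm_exp]; simp [hs]
    have ha := harc _ (exp_im_nonneg htS.2.1 htS.2.2) hn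
    refine ⟨_, ?_, hH _ htS ha.1⟩
    rw [norm_mul, hn]
    have hsum := norm_sum_blaschkeLogDeriv_le p m (z := Complex.exp (α + t * Complex.I)) hZim hc
      (by rw [hn]; exact hs1) (by rw [hn]; exact hZc)
    rw [hn] at hsum
    have hsum' := mul_le_mul_of_nonneg_left (hW s hs1) (show 0 ≤ 2 / c by positivity)
    gcongr
    refine (norm_sub_le _ _).trans (add_le_add ha.2 ?_)
    linarith
  have hre0 : 0 ≤ ζ.re := hα.trans hζ.1.1
  have hE : 1 ≤ Real.exp (σ * ζ.re) := Real.one_le_exp (mul_nonneg hσ0 hre0)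
  have hfin : N₀ + K₁ ≤ (N₀ + K₁) * Real.exp (σ * ζ.re) :=
    le_mul_of_one_le_right (by positivity) hE
  have hCρ : 0 ≤ C₀ / |ρ| := by positivity
  rcases hside with h | h | h
  · have h1 := norm_le_on_horizontal_side p (η := 0) (ε := 1) hα hC₀ hρ hσ0 hσρ hZim hW hreal hH
      (by simp) (by simp) (by simp) (by simp [Real.pi_pos.le])
      (by simpa using hleft 0 ⟨le_rfl, Real.pi_pos.le⟩) hζ.1
    have h2 : ((ζ.re : ℝ) : ℂ) + 0 = ζ := by
      apply Complex.ext <;> simp [h]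
    rw [h2] at h1
    linarith
  · have h1 := norm_le_on_horizontal_side p (η := Real.pi * Complex.I) (ε := -1) hα hC₀ hρ hσ0 hσρ
      hZim hW hreal hH (by simp) (by simp [Complex.exp_pi_mul_I]) (by simp)
      (by simp [Real.pi_pos.le]) (hleft Real.pi ⟨Real.pi_pos.le, le_rfl⟩) hζ.1
    have h2 : ((ζ.re : ℝ) : ℂ) + Real.pi * Complex.I = ζ := by
      apply Complex.ext <;> simp [h]
    rw [h2] at h1
    linarith
  · have h1 := hleft ζ.im hζ.2
    have h2 : (α : ℂ) + ζ.im * Complex.I = ζ := by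
      apply Complex.ext <;> simp [h]
    rw [h2] at h1
    have h3 : 0 ≤ (C₀ / |ρ| + 8 * K) * Real.exp (σ * ζ.re) := by positivity
    linarith

/-! ### Zero counts and the choice of the inner and outer radii -/

theorem analyticOrderAt_ne_top_of_zeroCount_lt_top {f : ℂ → ℂ} {r : ℝ} (hr : zeroCount f r < ⊤)
    {z : ℂ} (hz : z ∈ upperExterior) (hzr : ‖z‖ ≤ r) : analyticOrderAt f z ≠ ⊤ := by
  intro h
  have h1 : ((analyticOrderAt f z : ℕ∞) : ℝ≥0∞) ≤ zeroCount f r :=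
    ENNReal.le_tsum (f := fun z : {z : ℂ | z ∈ upperExterior ∧ ‖z‖ ≤ r} =>
      (analyticOrderAt f (z : ℂ) : ℝ≥0∞)) ⟨z, hz, hzr⟩
  rw [h, ENat.toENNReal_top, top_le_iff] at h1
  exact hr.ne h1

theorem sum_analyticOrderNatAt_le_of_zeroCount_le {f : ℂ → ℂ} {r M : ℝ} (hM : 0 ≤ M)
    (hr : zeroCount f r ≤ ENNReal.ofReal M) (s : Finset ℂ)
    (hs : ∀ z ∈ s, z ∈ upperExterior ∧ ‖z‖ ≤ r) : ∑ z ∈ s, (analyticOrderNatAt f z : ℝ) ≤ M := by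
  set S : Set ℂ := {z : ℂ | z ∈ upperExterior ∧ ‖z‖ ≤ r} with hS
  have h1 : ∑ z ∈ s, ((analyticOrderAt f z : ℕ∞) : ℝ≥0∞) ≤ zeroCount f r := by
    unfold zeroCount
    rw [tsum_subtype S (fun z => ((analyticOrderAt f z : ℕ∞) : ℝ≥0∞))]
    refine le_trans (le_of_eq ?_) (ENNReal.sum_le_tsum s)
    refine Finset.sum_congr rfl fun z hz => ?_
    rw [Set.indicator_of_mem (s := S) (hs z hz)]
  have h2 : ∑ z ∈ s, ((analyticOrderAt f z : ℕ∞) : ℝ≥0∞) =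
      ENNReal.ofReal (∑ z ∈ s, (analyticOrderNatAt f z : ℝ)) := by
    rw [ENNReal.ofReal_sum_of_nonneg fun _ _ => Nat.cast_nonneg _]
    refine Finset.sum_congr rfl fun z hz => ?_
    have := analyticOrderAt_ne_top_of_zeroCount_lt_top (hr.trans_lt ENNReal.ofReal_lt_top)
      (hs z hz).1 (hs z hz).2
    rw [← Nat.cast_analyticOrderNatAt this]
    simp
  rw [h2] at h1
  exact (ENNReal.ofReal_le_ofReal_iff hM).1 (h1.trans hr)

theorem card_le_sum_analyticOrderNatAt {f : ℂ → ℂ} (hf : AnalyticOnNhd ℂ f upperExterior)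
    (hord : ∀ z ∈ upperExterior, analyticOrderAt f z ≠ ⊤) (s : Finset ℂ)
    (hs : ∀ z ∈ s, z ∈ upperExterior ∧ f z = 0) :
    (s.card : ℝ) ≤ ∑ z ∈ s, (analyticOrderNatAt f z : ℝ) := by
  rw [Finset.card_eq_sum_ones, Nat.cast_sum]
  refine Finset.sum_le_sum fun z hz => ?_
  have h1 : analyticOrderNatAt f z ≠ 0 := by
    intro h0
    have h2 := Nat.cast_analyticOrderNatAt (hord z (hs z hz).1)
    rw [h0, Nat.cast_zero] at h2
    exact (hf z (hs z hz).1).analyticOrderAt_ne_zero.2 (hs z hz).2 h2.symm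
  exact_mod_cast Nat.one_le_iff_ne_zero.2 h1

/-- A finite bound for the number of zeros in a half annulus makes the zero set finite. -/
theorem finite_zeros_of_zeroCount_le {f : ℂ → ℂ} (hf : AnalyticOnNhd ℂ f upperExterior)
    (hord : ∀ z ∈ upperExterior, analyticOrderAt f z ≠ ⊤) {r M : ℝ} (hM : 0 ≤ M)
    (hr : zeroCount f r ≤ ENNReal.ofReal M) :
    {z : ℂ | z ∈ upperExterior ∧ ‖z‖ ≤ r ∧ f z = 0}.Finite := by
  by_contra hinf
  obtain ⟨n, hn⟩ := exists_nat_gt M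
  obtain ⟨t, ht, htn⟩ := Set.Infinite.exists_subset_card_eq hinf n
  have h1 := card_le_sum_analyticOrderNatAt hf hord t fun z hz => ⟨(ht hz).1, (ht hz).2.2⟩
  have h2 := sum_analyticOrderNatAt_le_of_zeroCount_le hM hr t
    fun z hz => ⟨(ht hz).1, (ht hz).2.1⟩
  rw [htn] at h1
  linarith

/-- A radius which separates the zeros inside from the zeros outside. -/
theorem exists_separating_radius {S : Set ℂ} (hS : ∀ r : ℝ, {z | z ∈ S ∧ ‖z‖ ≤ r}.Finite) :
    ∃ s c : ℝ, 1 ≤ s ∧ s ≤ 2 ∧ 0 < c ∧ ∀ z ∈ S, ‖z‖ ≠ s ∧ (s ≤ ‖z‖ → c * ‖z‖ ≤ ‖z‖ - s) := by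
  have hinf : (Set.Ico (1 : ℝ) 2).Infinite := Set.Ico_infinite (by norm_num)
  obtain ⟨s, hs, hsn⟩ := hinf.exists_notMem_finset ((hS 2).image norm).toFinset
  have hne : ∀ z ∈ S, ‖z‖ ≠ s := by
    intro z hz h
    apply hsn
    rw [Set.Finite.mem_toFinset]
    exact ⟨z, ⟨hz, by rw [h]; exact hs.2.le⟩, h⟩
  have hev : ∀ᶠ c : ℝ in nhdsWithin 0 (Set.Ioi 0),
      ∀ z ∈ (hS 2).toFinset, s ≤ ‖z‖ → c * ‖z‖ < ‖z‖ - s := by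
    rw [Filter.eventually_all_finset]
    intro z hz
    rw [Set.Finite.mem_toFinset] at hz
    by_cases h : s ≤ ‖z‖
    · have h1 : Filter.Tendsto (fun c : ℝ => c * ‖z‖) (nhdsWithin 0 (Set.Ioi 0))
          (nhds (0 * ‖z‖)) :=
        (Filter.Tendsto.mul_const _ Filter.tendsto_id).mono_left nhdsWithin_le_nhds
      rw [zero_mul] at h1
      have h2 : s < ‖z‖ := lt_of_le_of_ne h (hne z hz.1).symm
      filter_upwards [h1.eventually_lt_const (sub_pos.2 h2)] with c hc _ using hc
    · exact Filter.Eventually.of_forall fun c hc => absurd hc h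
  obtain ⟨c, hc, hc0⟩ := (hev.and self_mem_nhdsWithin).exists
  have hc0' : 0 < c := hc0
  -- This serves the infinitely many possible points with |z| > 2, where |z| - s ≥ (1 - s/2)|z|.
  have hs2 : 0 < 1 - s / 2 := by linarith [hs.2]
  refine ⟨s, min c (1 - s / 2), hs.1, hs.2.le, lt_min hc0' hs2, fun z hz => ⟨hne z hz, fun hsz => ?_⟩⟩
  by_cases h2 : ‖z‖ ≤ 2
  · have := hc z (by rw [Set.Finite.mem_toFinset]; exact ⟨hz, h2⟩) hsz
    have := mul_le_mul_of_nonneg_right (min_le_left c (1 - s / 2)) (norm_nonneg z)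
    linarith
  · have := mul_le_mul_of_nonneg_right (min_le_right c (1 - s / 2)) (norm_nonneg z)
    have hs1 := hs.1
    push Not at h2
    nlinarith

/-- Pigeonhole: among the radii in `[T, 2 T]` there is one below which there is a zero-free gap. -/
theorem exists_radius_gap {S : Set ℂ} {T : ℝ} {n : ℕ} (hT : 0 < T)
    (hS : ∀ t : Finset ℂ, (∀ z ∈ t, z ∈ S ∧ ‖z‖ ≤ 2 * T) → t.card ≤ n) :
    ∃ R : ℝ, T ≤ R ∧ R ≤ 2 * T ∧ ∀ z ∈ S, ‖z‖ ≤ R → ‖z‖ ≤ R - T / (n + 1) := by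
  classical
  by_contra hcon
  push Not at hcon
  have hn : (0 : ℝ) < n + 1 := by positivity
  -- If every radius failed, each of the n + 1 equal subintervals of [T, 2T] would contain the
  -- modulus of a zero, giving n + 1 distinct zeros.
  have hk : ∀ k : Fin (n + 1), ∃ z ∈ S, ‖z‖ ≤ T + (k + 1) * (T / (n + 1)) ∧
      T + k * (T / (n + 1)) < ‖z‖ := by
    intro k
    have hkn : (k : ℝ) + 1 ≤ n + 1 := by exact_mod_cast k.2
    have h1 : ((k : ℝ) + 1) * (T / (n + 1)) ≤ T := by
      rw [← mul_div_assoc, div_le_iff₀ hn, mul_comm]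
      gcongr
    obtain ⟨z, hz, hz1, hz2⟩ := hcon (T + (k + 1) * (T / (n + 1)))
      (by have : 0 ≤ ((k : ℝ) + 1) * (T / (n + 1)) := by positivity
          linarith) (by linarith)
    exact ⟨z, hz, hz1, by linarith⟩
  choose z hzS hz1 hz2 using hk
  have hd : 0 < T / ((n : ℝ) + 1) := by positivity
  have hinj : Function.Injective z := by
    intro i j hij
    by_contra hne
    wlog hlt : i < j generalizing i j
    · exact this hij.symm (Ne.symm hne) (lt_of_le_of_ne (not_lt.1 hlt) (Ne.symm hne))
    have h1 := hz1 i
    have h2 := hz2 j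
    rw [hij] at h1
    have h3 : (i : ℝ) + 1 ≤ j := by exact_mod_cast hlt
    have h4 := mul_le_mul_of_nonneg_right h3 hd.le
    linarith
  have := hS (Finset.univ.image z) (by
    intro w hw
    obtain ⟨k, -, rfl⟩ := Finset.mem_image.1 hw
    refine ⟨hzS k, (hz1 k).trans ?_⟩
    have hkn : (k : ℝ) + 1 ≤ n + 1 := by exact_mod_cast k.2
    have h1 : ((k : ℝ) + 1) * (T / (n + 1)) ≤ T := by
      rw [← mul_div_assoc, div_le_iff₀ hn, mul_comm]
      gcongr
    linarith)
  rw [Finset.card_image_of_injective _ hinj] at this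
  simp at this

/-- This is the price of bounding |B| from below: one power R^σ for the inverse gap width, another
for the number of zeros. Hence the requirement M ≥ 2σ. -/
theorem four_mul_succ_mul_count_le {σ N R T M : ℝ} {n : ℕ} (hσ : 0 ≤ σ) (hN : 0 ≤ N) (hT : 1 ≤ T)
    (hTR : T ≤ R) (hn : (n : ℝ) ≤ N * (2 * T) ^ σ + 1) (hM : 2 * σ ≤ M) :
    4 * ((n : ℝ) + 1) * (N * R ^ σ) ≤ 4 * (N * 2 ^ σ + 2) * N * R ^ M := by
  have hR1 : 1 ≤ R := hT.trans hTR
  have h1 : 1 ≤ R ^ σ := Real.one_le_rpow hR1 hσ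
  have h2 : (2 * T) ^ σ ≤ 2 ^ σ * R ^ σ := by
    rw [Real.mul_rpow (by norm_num) (by linarith)]
    gcongr
  have h3 : (n : ℝ) + 1 ≤ (N * 2 ^ σ + 2) * R ^ σ := by
    have := mul_le_mul_of_nonneg_left h2 hN
    linarith
  have h4 : R ^ σ * R ^ σ ≤ R ^ M := by
    rw [← Real.rpow_add (by linarith)]
    exact Real.rpow_le_rpow_of_exponent_le hR1 (by linarith)
  calc 4 * ((n : ℝ) + 1) * (N * R ^ σ) ≤ 4 * ((N * 2 ^ σ + 2) * R ^ σ) * (N * R ^ σ) := by gcongr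
    _ = 4 * (N * 2 ^ σ + 2) * N * (R ^ σ * R ^ σ) := by ring
    _ ≤ _ := by gcongr

/-! ### The growth estimate -/

/-- The growth estimate outside a half disc, with the order `σ` of the zeros and of the boundary
values of `log f` not a positive integer. -/
theorem exists_norm_le_exp_rpow {f : ℂ → ℂ} {ρ σ N C₀ ρ₁ C₁ : ℝ} (p : ℕ)
    (hf : AnalyticOnNhd ℂ f upperExterior)
    (hreal : ∀ x : ℝ, 1 ≤ |x| → f (x : ℂ) ≠ 0)
    (hρ : ρ ≠ 0) (hσ0 : 0 ≤ σ) (hσρ : ρ ≤ σ)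
    (hp : ∀ j : ℕ, 1 ≤ j → j ≤ p → (j : ℝ) < σ) (hσp : σ < p + 1)
    (hN : 0 ≤ N) (hC₀ : 0 ≤ C₀)
    (hn : ∀ r : ℝ, 1 ≤ r → zeroCount f r ≤ ENNReal.ofReal (N * r ^ σ))
    (hderiv : ∀ x : ℝ, 1 ≤ |x| → ‖deriv f (x : ℂ) / f (x : ℂ)‖ ≤ C₀ * |x| ^ (ρ - 1))
    (hgrowth : ∀ z ∈ upperExterior, f z ≠ 0 → Real.log ‖f z‖ ≤ C₁ * (1 + ‖z‖ ^ ρ₁)) :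
    ∃ s K : ℝ, 0 ≤ K ∧ s ≤ 2 ∧
      ∀ z : ℂ, 0 ≤ z.im → s ≤ ‖z‖ → ‖f z‖ ≤ Real.exp (K * ‖z‖ ^ σ) := by
  classical
  have hord : ∀ z ∈ upperExterior, analyticOrderAt f z ≠ ⊤ := fun z hz =>
    analyticOrderAt_ne_top_of_zeroCount_lt_top ((hn ‖z‖ hz.2).trans_lt ENNReal.ofReal_lt_top) hz
      le_rfl
  have hNr : ∀ r : ℝ, 1 ≤ r → 0 ≤ N * r ^ σ := fun r hr => by positivity
  set S : Set ℂ := {z | z ∈ upperExterior ∧ f z = 0} with hS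
  have hfin : ∀ r : ℝ, {z | z ∈ S ∧ ‖z‖ ≤ r}.Finite := by
    intro r
    have hr1 : 1 ≤ max r 1 := le_max_right _ _
    refine (finite_zeros_of_zeroCount_le hf hord (hNr _ hr1) (hn _ hr1)).subset ?_
    rintro z ⟨⟨h1, h2⟩, h3⟩
    exact ⟨h1, h3.trans (le_max_left _ _), h2⟩
  obtain ⟨s, c, hs1, hs2, hc, hsep⟩ := exists_separating_radius hfin
  have hs0 : 0 < s := by linarith
  obtain ⟨L, hL⟩ : ∃ L : ℝ, ∀ z ∈ {z : ℂ | 0 ≤ z.im ∧ ‖z‖ = s}, ‖deriv f z / f z‖ ≤ L := by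
    refine IsCompact.exists_bound_of_continuousOn ?_ ?_
    · refine Metric.isCompact_of_isClosed_isBounded ?_ ?_
      · exact (isClosed_le continuous_const Complex.continuous_im).inter
          (isClosed_eq continuous_norm continuous_const)
      · refine (Metric.isBounded_closedBall (x := (0 : ℂ)) (r := s)).subset ?_
        rintro z ⟨-, hz⟩
        simp [hz]
    · rintro z ⟨hz, hzs⟩
      have hzΩ : z ∈ upperExterior := ⟨hz, by rw [hzs]; exact hs1⟩
      have hfz : f z ≠ 0 := fun h => (hsep z ⟨hzΩ, h⟩).1 hzs
      exact ((hf z hzΩ).deriv.continuousAt.div (hf z hzΩ).continuousAt hfz).continuousWithinAt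
  obtain ⟨W, hW0, hW⟩ := exists_sum_genusWeight_le (N := N) (σ := σ) p hN hp hσp
  have hexpα : Real.exp (Real.log s) = s := Real.exp_log hs0
  have hα0 : 0 ≤ Real.log s := Real.log_nonneg hs1
  set α : ℝ := Real.log s with hα
  set N₀ : ℝ := |Real.log ‖f (Real.exp α : ℝ)‖| + Real.pi with hN₀
  -- Neither K nor the constant A below depends on z or on the outer radius R, which are chosen
  -- later.
  set K : ℝ := N₀ + Real.pi * ((|L| + 2 / c * W * Real.exp α ^ σ) * Real.exp α) + C₀ / |ρ| + 8 * W
    with hK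
  have hK0 : 0 < K := by
    have := Real.pi_pos
    have : 0 < N₀ := by positivity
    positivity
  set M : ℝ := max (2 * σ) ρ₁ with hM
  have hM1 : 2 * σ ≤ M := le_max_left _ _
  -- The three summands come from the growth of f, from the lower bound for |B|, and from the
  -- requirement 4K ≤ A.
  set A : ℝ := 2 * |C₁| + (4 * (N * 2 ^ σ + 2) * N + 4 * W) + 4 * K with hA
  have hA0 : 0 < A := by positivity
  have hKA : 4 * K ≤ A := by
    have : 0 ≤ 2 * |C₁| + (4 * (N * 2 ^ σ + 2) * N + 4 * W) := by positivity
    linarith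
  refine ⟨s, 4 * W + K * Real.exp 1, by positivity, hs2, fun z hz hzs => ?_⟩
  have hz0 : z ≠ 0 := by
    rintro rfl
    rw [norm_zero] at hzs
    linarith
  have hzn : 0 < ‖z‖ := norm_pos_iff.2 hz0
  have hζre : α ≤ (Complex.log z).re := by
    rw [Complex.log_re]
    exact Real.log_le_log hs0 hzs
  have hζ0 : 0 ≤ (Complex.log z).im := by
    rw [Complex.log_im]
    exact Complex.arg_nonneg_iff.2 hz
  have hζ1 : (Complex.log z).im ≤ Real.pi := by
    rw [Complex.log_im]
    exact Complex.arg_le_pi z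
  obtain ⟨β₀, hβ₀⟩ := norm_le_of_strip_family (σ := σ) (m := M) hα0 hσ0 hK0 hA0 (by linarith) hKA
    hζre hζ0 hζ1
  -- choice of the outer radius
  set T : ℝ := max (Real.exp β₀) (max 2 ‖z‖) with hT
  have hT2 : 2 ≤ T := (le_max_left _ _).trans (le_max_right _ _)
  have hTz : ‖z‖ ≤ T := (le_max_right _ _).trans (le_max_right _ _)
  have hTβ : Real.exp β₀ ≤ T := le_max_left _ _
  set n : ℕ := ⌈N * (2 * T) ^ σ⌉₊ with hnn
  have hn1 : (n : ℝ) ≤ N * (2 * T) ^ σ + 1 := (Nat.ceil_lt_add_one (hNr _ (by linarith))).le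
  obtain ⟨R, hTR, hRT, hgap⟩ := exists_radius_gap (S := S) (T := T) (n := n) (by linarith) (by
    intro t ht
    have h1 := card_le_sum_analyticOrderNatAt hf hord t fun w hw => (ht w hw).1
    have h2 := sum_analyticOrderNatAt_le_of_zeroCount_le (hNr (2 * T) (by linarith))
      (hn (2 * T) (by linarith)) t fun w hw => ⟨(ht w hw).1.1, (ht w hw).2⟩
    have h3 := Nat.le_ceil (N * (2 * T) ^ σ)
    exact_mod_cast h1.trans (h2.trans h3))
  have hR0 : 0 < R := by linarith
  have hR1 : 1 ≤ R := by linarith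
  have hexpβ : Real.exp (Real.log R) = R := Real.exp_log hR0
  set β : ℝ := Real.log R with hβ
  have hαβ : α ≤ β := Real.log_le_log hs0 (by linarith)
  have hββ : β₀ ≤ β := by
    rw [← Real.exp_le_exp, hexpβ]
    exact hTβ.trans hTR
  set m : ℂ → ℕ := analyticOrderNatAt f with hm
  set Z : Finset ℂ := {a ∈ (hfin R).toFinset | s ≤ ‖a‖} with hZdef
  have hΩ : ∀ w : ℂ, 0 ≤ w.im → Real.exp α ≤ ‖w‖ → w ∈ upperExterior := fun w hw hw' =>
    ⟨hw, by rw [hexpα] at hw'; linarith⟩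
  have hZ : ∀ w : ℂ, w ∈ Z ↔ 0 ≤ w.im ∧ Real.exp α ≤ ‖w‖ ∧ ‖w‖ ≤ Real.exp β ∧ f w = 0 := by
    intro w
    rw [hZdef, Finset.mem_filter, Set.Finite.mem_toFinset, hexpα, hexpβ]
    constructor
    · rintro ⟨⟨⟨h1, h2⟩, h3⟩, h4⟩
      exact ⟨h1.1, h4, h3, h2⟩
    · rintro ⟨h1, h2, h3, h4⟩
      exact ⟨⟨⟨⟨h1, by linarith⟩, h4⟩, h3⟩, h2⟩
  have hZΩ : ∀ a ∈ Z, a ∈ S := fun a ha => by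
    obtain ⟨h1, h2, h3, h4⟩ := (hZ a).1 ha
    exact ⟨hΩ a h1 h2, h4⟩
  have hZn : ∀ a ∈ Z, 1 ≤ ‖a‖ := fun a ha => (hZΩ a ha).1.2
  have hZim : ∀ a ∈ Z, 0 < a.im := by
    intro a ha
    refine lt_of_le_of_ne (hZΩ a ha).1.1 fun h0 => ?_
    have hare : a = ((a.re : ℝ) : ℂ) := by apply Complex.ext <;> simp [← h0]
    refine hreal a.re ?_ (by rw [← hare]; exact (hZΩ a ha).2)
    have := hZn a ha
    rwa [hare, Complex.norm_real, Real.norm_eq_abs] at this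
  have hZc : ∀ a ∈ Z, c * ‖a‖ ≤ ‖a‖ - Real.exp α := fun a ha => by
    have := ((hZ a).1 ha).2.1
    rw [hexpα] at this ⊢
    exact (hsep a (hZΩ a ha)).2 this
  have hcount : ∀ r : ℝ, 1 ≤ r → ∑ a ∈ Z with ‖a‖ ≤ r, (m a : ℝ) ≤ N * r ^ σ := by
    intro r hr
    refine sum_analyticOrderNatAt_le_of_zeroCount_le (hNr r hr) (hn r hr) _ fun a ha => ?_
    rw [Finset.mem_filter] at ha
    exact ⟨(hZΩ a ha.1).1, ha.2⟩
  have hWZ : ∀ r : ℝ, 1 ≤ r → ∑ a ∈ Z, m a * genusWeight p (r / ‖a‖) ≤ W * r ^ σ :=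
    hW Z (fun a => ‖a‖) (fun a => m a) hZn (fun _ _ => Nat.cast_nonneg _) hcount
  have hrealα : ∀ x : ℝ, Real.exp α ≤ |x| → 1 ≤ |x| := fun x hx => by
    rw [hexpα] at hx; linarith
  obtain ⟨H, hHan, hHeq, hHd, hHα⟩ := exists_log_div_blaschkeProd p hαβ Z
    (fun w h1 h2 => hf w (hΩ w h1 h2)) (fun w h1 h2 => hord w (hΩ w h1 h2)) hZ hZim
  have hside : ∀ w ∈ Set.Icc α β ×ℂ Set.Icc 0 Real.pi,
      (w.im = 0 ∨ w.im = Real.pi ∨ w.re = α) → ‖H w‖ ≤ K * Real.exp (σ * w.re) := by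
    intro w hw hw'
    refine norm_le_on_sides p (L := |L|) hα0 hC₀ hc (abs_nonneg L) hW0.le hρ hσ0 hσρ hZim hZc hWZ
      (fun x hx => ⟨hreal x (hrealα x hx), hderiv x (hrealα x hx)⟩) (fun w h1 h2 => ?_) hHα hHd
      hw hw'
    rw [hexpα] at h2
    have hwΩ : w ∈ upperExterior := ⟨h1, by rw [h2]; exact hs1⟩
    exact ⟨fun h => (hsep w ⟨hwΩ, h⟩).1 h2, (hL w ⟨h1, h2⟩).trans (le_abs_self L)⟩
  have hright : ∀ w ∈ Set.Icc α β ×ℂ Set.Icc 0 Real.pi, w.re = β →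
      (H w).re ≤ A * Real.exp (M * β) := by
    intro w hw hwβ
    have hwn : ‖Complex.exp w‖ = R := by rw [Complex.norm_exp, hwβ, hexpβ]
    have hwim := exp_im_nonneg hw.2.1 hw.2.2
    have hwΩ : Complex.exp w ∈ upperExterior := ⟨hwim, by rw [hwn]; exact hR1⟩
    have hδ : 0 < T / ((n : ℝ) + 1) := by
      have : 0 < T := by linarith
      positivity
    have hfw : f (Complex.exp w) ≠ 0 := by
      intro h
      have := hgap _ ⟨hwΩ, h⟩ hwn.le
      rw [hwn] at this
      linarith
    -- This κ gives δκ = 4T, which is at least 2R because R ≤ 2T.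
    have hlow := le_norm_blaschkeProd p m hZim (z := Complex.exp w) (κ := 4 * ((n : ℝ) + 1))
      (δ := T / ((n : ℝ) + 1)) hwim hδ.le
      (by
        rw [hwn]
        have : T / ((n : ℝ) + 1) * (4 * ((n : ℝ) + 1)) = 4 * T := by field_simp
        linarith) (by rw [hwn]; exact hR0)
      (fun a ha => by
        rw [hwn]
        have := ((hZ a).1 ha).2.2.1
        rw [hexpβ] at this
        exact hgap a (hZΩ a ha) this)
    have hB0 : 0 < ‖blaschkeProd p Z m (Complex.exp w)‖ := (Real.exp_pos _).trans_le hlow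
    rw [← Real.le_log_iff_exp_le hB0, hwn] at hlow
    have hlog : Real.log ‖f (Complex.exp w)‖ =
        Real.log ‖blaschkeProd p Z m (Complex.exp w)‖ + (H w).re := by
      rw [hHeq w hw, norm_mul, Complex.norm_exp, Real.log_mul hB0.ne' (Real.exp_pos _).ne',
        Real.log_exp]
    have hgr := hgrowth _ hwΩ hfw
    rw [hwn, hlog] at hgr
    have e0 : 0 ≤ M := by linarith
    have e1 : Real.exp (M * β) = R ^ M := by
      rw [mul_comm, Real.exp_mul, hexpβ]
    have e2 : 1 ≤ R ^ M := Real.one_le_rpow hR1 e0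
    have e3 : R ^ ρ₁ ≤ R ^ M := Real.rpow_le_rpow_of_exponent_le hR1 (le_max_right _ _)
    have e4 : C₁ * (1 + R ^ ρ₁) ≤ 2 * |C₁| * R ^ M := by
      have h1 : C₁ * (1 + R ^ ρ₁) ≤ |C₁| * (1 + R ^ ρ₁) := by
        gcongr
        exact le_abs_self _
      have h2 : |C₁| * (1 + R ^ ρ₁) ≤ |C₁| * (R ^ M + R ^ M) := by gcongr
      linarith
    have e5 : ∑ a ∈ Z, (m a : ℝ) ≤ N * R ^ σ := by
      have := hcount R hR1
      rwa [Finset.filter_true_of_mem fun a ha => by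
        have := ((hZ a).1 ha).2.2.1
        rwa [hexpβ] at this] at this
    have e6 := four_mul_succ_mul_count_le hσ0 hN (by linarith) hTR hn1 hM1
    have e7 : 4 * ((n : ℝ) + 1) * ∑ a ∈ Z, (m a : ℝ) ≤ 4 * ((n : ℝ) + 1) * (N * R ^ σ) := by
      gcongr
    have e8 : W * R ^ σ ≤ W * R ^ M := by
      gcongr
      linarith
    have e9 := hWZ R hR1
    have e10 : 0 ≤ K * R ^ M := by positivity
    rw [e1, hA]
    linarith
  have hHz := hβ₀ β hββ H hHan hside hright
  have hζmem : Complex.log z ∈ Set.Icc α β ×ℂ Set.Icc 0 Real.pi := by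
    refine ⟨⟨hζre, ?_⟩, hζ0, hζ1⟩
    rw [Complex.log_re]
    exact Real.log_le_log hzn (hTz.trans hTR)
  have hfz := hHeq _ hζmem
  rw [Complex.exp_log hz0] at hfz
  rw [hfz, norm_mul, Complex.norm_exp, add_mul, Real.exp_add]
  gcongr
  · refine (norm_blaschkeProd_le p m hZim hz).trans ?_
    rw [Real.exp_le_exp, mul_assoc]
    gcongr
    exact hWZ _ (hs1.trans hzs)
  · refine (Complex.re_le_norm _).trans (hHz.trans_eq ?_)
    rw [Complex.log_re, mul_comm σ, Real.exp_mul (Real.log ‖z‖), Real.exp_log hzn]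

theorem mainTheorem3 (f : ℂ → ℂ) (ρ C₀ ρ₁ C₁ : ℝ)
    (hf : AnalyticOnNhd ℂ f upperExterior)
    (hreal : ∀ x : ℝ, 1 ≤ |x| → f (x : ℂ) ≠ 0)
    (hρ : ∀ k : ℤ, ρ ≠ (k : ℝ))
    (hn : ∀ r : ℝ, 1 ≤ r → zeroCount f r ≤ ENNReal.ofReal (C₀ * (1 + r ^ ρ)))
    (hderiv : ∀ x : ℝ, 1 ≤ |x| →
      ‖deriv f (x : ℂ) / f (x : ℂ)‖ ≤ C₀ * (1 + |x| ^ (ρ - 1)))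
    (hderiv_small : ρ < 1 → ∀ x : ℝ, 1 ≤ |x| →
      ‖deriv f (x : ℂ) / f (x : ℂ)‖ ≤ C₀ * |x| ^ (ρ - 1))
    (hgrowth : ∀ z ∈ upperExterior, f z ≠ 0 →
      Real.log ‖f z‖ ≤ C₁ * (1 + ‖z‖ ^ ρ₁)) :
    ∃ C : ℝ, ∀ z ∈ upperExterior, ‖f z‖ ≤ C * Real.exp (C * ‖z‖ ^ ρ) := by
  have hC₀ : 0 ≤ C₀ := by
    have h := (norm_nonneg _).trans (hderiv 1 (by simp))
    simp at h
    linarith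
  have hρ0 : ρ ≠ 0 := by simpa using hρ 0
  -- For ρ < 0 the number of zeros and log f on the axis are bounded, so the estimate runs with
  -- order and genus 0.
  set σ : ℝ := max ρ 0 with hσ
  have hσ0 : 0 ≤ σ := le_max_right _ _
  have hσρ : ρ ≤ σ := le_max_left _ _
  have hp : ∀ j : ℕ, 1 ≤ j → j ≤ ⌊σ⌋₊ → (j : ℝ) < σ := by
    intro j hj hjσ
    have h1 : (j : ℝ) ≤ σ := (Nat.le_floor_iff hσ0).1 hjσ
    refine lt_of_le_of_ne h1 fun h2 => ?_
    have h3 : (1 : ℝ) ≤ j := by exact_mod_cast hj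
    rcases max_choice ρ 0 with h | h
    · exact hρ j (by rw [← h, ← hσ, ← h2]; simp)
    · rw [hσ, h] at h2
      linarith
  have hn' : ∀ r : ℝ, 1 ≤ r → zeroCount f r ≤ ENNReal.ofReal (2 * C₀ * r ^ σ) := by
    intro r hr
    refine (hn r hr).trans (ENNReal.ofReal_le_ofReal ?_)
    have h1 : 1 ≤ r ^ σ := Real.one_le_rpow hr hσ0
    have h2 : r ^ ρ ≤ r ^ σ := Real.rpow_le_rpow_of_exponent_le hr hσρ
    calc C₀ * (1 + r ^ ρ) ≤ C₀ * (r ^ σ + r ^ σ) := by gcongr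
      _ = _ := by ring
  have hderiv' : ∀ x : ℝ, 1 ≤ |x| →
      ‖deriv f (x : ℂ) / f (x : ℂ)‖ ≤ 2 * C₀ * |x| ^ (ρ - 1) := by
    intro x hx
    have hpos : 0 ≤ C₀ * |x| ^ (ρ - 1) := by positivity
    -- For ρ ≥ 1 the constant 1 is absorbed by |x|^(ρ-1). For ρ < 1 it would integrate to linear
    -- growth, hence the separate hypothesis.
    rcases lt_or_ge ρ 1 with h | h
    · linarith [hderiv_small h x hx]
    · have h1 : 1 ≤ |x| ^ (ρ - 1) := Real.one_le_rpow hx (by linarith)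
      have h2 := mul_le_mul_of_nonneg_left h1 hC₀
      linarith [hderiv x hx]
  obtain ⟨s, K, hK, hs2, hbound⟩ := exists_norm_le_exp_rpow ⌊σ⌋₊ hf hreal hρ0 hσ0 hσρ hp
    (Nat.lt_floor_add_one σ) (by positivity) (by positivity) hn' hderiv' hgrowth
  obtain ⟨B, hB⟩ : ∃ B : ℝ, ∀ z ∈ {z : ℂ | z ∈ upperExterior ∧ ‖z‖ ≤ 2}, ‖f z‖ ≤ B := by
    refine IsCompact.exists_bound_of_continuousOn ?_ fun z hz =>
      (hf z hz.1).continuousAt.continuousWithinAt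
    refine Metric.isCompact_of_isClosed_isBounded ?_ ?_
    · exact ((isClosed_le continuous_const Complex.continuous_im).inter
        (isClosed_le continuous_const continuous_norm)).inter
        (isClosed_le continuous_norm continuous_const)
    · refine (Metric.isBounded_closedBall (x := (0 : ℂ)) (r := 2)).subset ?_
      rintro z ⟨-, hz⟩
      simpa using hz
  have hexpK := Real.exp_pos K
  -- The summand |B| covers the compact part |z| ≤ 2, K the exponent when σ = ρ, and exp K the
  -- bounded case σ = 0.
  refine ⟨|B| + K + Real.exp K + 1, fun z hz => ?_⟩
  set C : ℝ := |B| + K + Real.exp K + 1 with hC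
  have hBabs := abs_nonneg B
  have hzρ : 0 ≤ ‖z‖ ^ ρ := by positivity
  have hC0 : 0 ≤ C := by positivity
  have hexp1 : 1 ≤ Real.exp (C * ‖z‖ ^ ρ) := Real.one_le_exp (mul_nonneg hC0 hzρ)
  by_cases hzs : s ≤ ‖z‖
  · refine (hbound z hz.1 hzs).trans ?_
    rcases max_choice ρ 0 with h | h
    · rw [hσ, h]
      have h1 : Real.exp (K * ‖z‖ ^ ρ) ≤ Real.exp (C * ‖z‖ ^ ρ) := by
        rw [Real.exp_le_exp]
        gcongr
        linarith
      have h2 : Real.exp (C * ‖z‖ ^ ρ) ≤ C * Real.exp (C * ‖z‖ ^ ρ) :=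
        le_mul_of_one_le_left (Real.exp_pos _).le (by linarith)
      exact h1.trans h2
    · rw [hσ, h, Real.rpow_zero, mul_one]
      have h2 : C ≤ C * Real.exp (C * ‖z‖ ^ ρ) := le_mul_of_one_le_right hC0 hexp1
      linarith
  · have h1 := hB z ⟨hz, by linarith⟩
    have h2 : C ≤ C * Real.exp (C * ‖z‖ ^ ρ) := le_mul_of_one_le_right hC0 hexp1
    linarith [le_abs_self B]
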